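/- **Setting.** Let $J(q)=\sum_{j\ge -1}c(j)q^j=q^{-1}+196884\,q+21493760\,q^2+\cdots$ be the normalized elliptic modular function, $I=\{(j,k)\mid j\in\{-1,1,2,3,\dots\},\ 1\le k\le c(j)\}$, and let $\mathfrak g(A)$ be the complex Lie algebra with generators $e_{jk},f_{jk},h_{jk}$, $(j,k)\in I$, and relations $$[h_{jk},h_{pq}]=0,\quad [h_{jk},e_{pq}]=-(j+p)e_{pq},\quad [h_{jk},f_{pq}]=(j+p)f_{pq},\quad [e_{jk},f_{pq}]=\delta_{jp}\delta_{kq}h_{jk},$$ together with $(\operatorname{ad}e_{-1,1})^{j}e_{jk}=0=(\operatorname{ad}f_{-1,1})^{j}f_{jk}$ for $j\ge1$. The Monster Lie algebra is $\mathfrak m=\mathfrak g(A)/\mathfrak z$, where $\mathfrak z$ is the center of $\mathfrak g(A)$. In $\mathfrak m$ put $h_1=\tfrac12(h_{-1,1}-h_{1,1})$ and $h_2=-\tfrac12(h_{-1,1}+h_{1,1})$; for integers $a,b$ let $\mathfrak m_{(a,b)}=\{x\in\mathfrak m\mid [h_1,x]=ax,\ [h_2,x]=bx\}$. Grade $\mathfrak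 m$ by $\mathbb Z$: $\mathfrak m_k=\bigoplus_{a+b=k}\mathfrak m_{(a,b)}$ for $k\ne0$, and $\mathfrak m_0=\mathfrak{gl}_2(-1)$ is the subalgebra generated by $e_{-1,1},f_{-1,1},h_1,h_2$. Let $\widehat{\mathfrak m}\subseteq\prod_{k\in\mathbb Z}\mathfrak m_k$ be the Lie algebra of formal sums $y=\sum_k (y)_k$ with $(y)_k\in\mathfrak m_k$ and $(y)_k=0$ for all sufficiently small $k$, with bracket $([x,y])_k=\sum_{i+j=k}[(x)_i,(y)_j]$. For $n\in\mathbb Z$ let $\widehat{\mathfrak n}^+_n=\prod_{j\ge n}\mathfrak m_j\cap\widehat{\mathfrak m}$. For $x\in\widehat{\mathfrak n}^+_1$ let $\exp(\operatorname{ad}x)=\sum_{i\ge0}\operatorname{ad}(x)^i/i!$, a well-defined automorphism of $\widehat{\mathfrak m}$ (in each degree the series applied to any $y$ has only finitely many nonzero terms). For $n\ge1$ let $$\widehat U^+_n=\{\varphi\in\operatorname{Aut}(\widehat{\mathfrak m})\mid \varphi(y)\in y+\widehat{\mathfrak n}^+_{k+n}\text{ for all }k\in\mathbb Z,\ y\in\mathfrak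 m_k\}.$$ Write $(X,Y)=XYX^{-1}Y^{-1}$ for the group commutator. **Statement.** For every integer $n\ge1$: 1. $\widehat U^+_n=\exp(\operatorname{ad}(\widehat{\mathfrak n}^+_n))=\{\exp(\operatorname{ad}x)\mid x\in\widehat{\mathfrak n}^+_n\}$. 2. $\exp(\operatorname{ad}x)\,\widehat U^+_{n+1}=\{\exp(\operatorname{ad}(x+z))\mid z\in\widehat{\mathfrak n}^+_{n+1}\}$ for all $x\in\mathfrak m_n$. 3. $\exp(\operatorname{ad}(x+y))\,\widehat U^+_{n+1}=\exp(\operatorname{ad}x)\exp(\operatorname{ad}y)\,\widehat U^+_{n+1}$ for all $x,y\in\mathfrak m_n$. 4. $\exp(\operatorname{ad}[x,y])\in\big(\exp(\operatorname{ad}x),\exp(\operatorname{ad}y)\big)\,\widehat U^+_{n+m+1}$ for all $m\ge1$, $x\in\mathfrak m_n$, $y\in\mathfrak m_m$. -/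

import Mathlib

namespace MonsterLie

noncomputable section

/-- The Eisenstein series `E₄ = 1 + 240 ∑ σ₃(n) qⁿ`. -/
def eisenstein4 : PowerSeries ℤ :=
  PowerSeries.mk fun n => if n = 0 then 1 else 240 * (ArithmeticFunction.sigma 3 n : ℤ)

/-- Euler's product `∏_{i ≥ 1} (1 - qⁱ)`; its `n`-th coefficient only depends on the factors with
`i ≤ n`. -/
def eulerProduct : PowerSeries ℤ :=
  PowerSeries.mk fun n =>
    PowerSeries.coeff n (∏ i ∈ Finset.range n, (1 - (PowerSeries.X : PowerSeries ℤ) ^ (i + 1)))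

/-- The series `q · J(q) = E₄³ / ∏ (1 - qⁱ)²⁴ - 744 q`, where `J = j - 744 = q⁻¹ + 196884 q + ⋯` is
the normalized elliptic modular function. -/
def qTimesJ : PowerSeries ℤ :=
  eisenstein4 ^ 3 * PowerSeries.invOfUnit (eulerProduct ^ 24) 1 - 744 * PowerSeries.X

/-- The coefficient `c(j)` of `q ^ j` in `J(q)`, for `j ≥ -1`. -/
def c (j : ℤ) : ℤ := PowerSeries.coeff (j + 1).toNat qTimesJ

theorem coeff_mul_012 (f g : PowerSeries ℤ) :
    PowerSeries.coeff 0 (f * g) = PowerSeries.coeff 0 f * PowerSeries.coeff 0 g ∧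
    PowerSeries.coeff 1 (f * g) = PowerSeries.coeff 0 f * PowerSeries.coeff 1 g +
      PowerSeries.coeff 1 f * PowerSeries.coeff 0 g ∧
    PowerSeries.coeff 2 (f * g) = PowerSeries.coeff 0 f * PowerSeries.coeff 2 g +
      PowerSeries.coeff 1 f * PowerSeries.coeff 1 g +
      PowerSeries.coeff 2 f * PowerSeries.coeff 0 g := by
  refine ⟨?_, ?_, ?_⟩ <;>
  (simp [PowerSeries.coeff_mul, Finset.Nat.antidiagonal_succ]; try ring)

/-- The series `f` has coefficients `a, b, d` in degrees `0, 1, 2`. -/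
def HasCoeff (f : PowerSeries ℤ) (a b d : ℤ) : Prop :=
  PowerSeries.coeff 0 f = a ∧ PowerSeries.coeff 1 f = b ∧ PowerSeries.coeff 2 f = d

theorem HasCoeff.mul {f g : PowerSeries ℤ} {a b d a' b' d' : ℤ} (hf : HasCoeff f a b d)
    (hg : HasCoeff g a' b' d') :
    HasCoeff (f * g) (a * a') (a * b' + b * a') (a * d' + b * b' + d * a') := by
  obtain ⟨rfl, rfl, rfl⟩ := hf
  obtain ⟨rfl, rfl, rfl⟩ := hg
  exact coeff_mul_012 f g

theorem qTimesJ_coeff : HasCoeff qTimesJ 1 0 196884 := by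
  have h4 : HasCoeff eisenstein4 1 240 2160 := by
    refine ⟨by simp [eisenstein4], by simp [eisenstein4], ?_⟩
    have : ArithmeticFunction.sigma 3 2 = 9 := by decide
    simp [eisenstein4, this]
  have he : HasCoeff eulerProduct 1 (-1) (-1) := by
    refine ⟨by simp [eulerProduct], by simp [eulerProduct], ?_⟩
    have h1 : HasCoeff (1 - (PowerSeries.X : PowerSeries ℤ)) 1 (-1) 0 := by
      refine ⟨by simp, by simp [PowerSeries.coeff_one], by simp [PowerSeries.coeff_one, PowerSeries.coeff_X]⟩
    have h2 : HasCoeff (1 - (PowerSeries.X : PowerSeries ℤ) ^ 2) 1 0 (-1) := by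
      refine ⟨by simp, ?_, ?_⟩ <;> simp [PowerSeries.coeff_one, PowerSeries.coeff_X_pow]
    have := (h1.mul h2).2.2
    simp [eulerProduct, Finset.prod_range_succ] at this ⊢
    exact this
  have h43 : HasCoeff (eisenstein4 ^ 3) 1 720 179280 := by
    have := (h4.mul h4).mul h4
    norm_num at this
    rwa [pow_succ, pow_two]
  have he24 : HasCoeff (eulerProduct ^ 24) 1 (-24) 252 := by
    have h2 := he.mul he
    have h3 := h2.mul he
    have h6 := h3.mul h3
    have h12 := h6.mul h6
    have h24 := h12.mul h12
    norm_num at h24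
    convert h24 using 1
    ring
  have hi : HasCoeff (PowerSeries.invOfUnit (eulerProduct ^ 24) 1) 1 24 324 := by
    have h := PowerSeries.mul_invOfUnit (eulerProduct ^ 24) 1 (by simpa using he24.1)
    have hh := he24.mul (⟨rfl, rfl, rfl⟩ : HasCoeff (PowerSeries.invOfUnit (eulerProduct ^ 24) 1) _ _ _)
    rw [h] at hh
    obtain ⟨h0, h1, h2⟩ := hh
    simp only [PowerSeries.coeff_one] at h0 h1 h2
    norm_num at h0 h1 h2
    refine ⟨?_, ?_, ?_⟩ <;> simp_all <;> linarith
  have := h43.mul hi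
  norm_num at this
  obtain ⟨h0, h1, h2⟩ := this
  have hX : HasCoeff (744 * PowerSeries.X) 0 744 0 := by
    rw [show (744 : PowerSeries ℤ) = PowerSeries.C 744 from rfl]
    refine ⟨?_, ?_, ?_⟩ <;> rw [PowerSeries.coeff_C_mul] <;> simp [PowerSeries.coeff_X]
  refine ⟨?_, ?_, ?_⟩
  · rw [qTimesJ, map_sub, h0, hX.1]; norm_num
  · rw [qTimesJ, map_sub, h1, hX.2.1]; norm_num
  · rw [qTimesJ, map_sub, h2, hX.2.2]; norm_num

theorem c_neg_one : c (-1) = 1 := qTimesJ_coeff.1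

theorem c_one : c 1 = 196884 := qTimesJ_coeff.2.2

/-- The index set `I = {(j, k) | j ∈ {-1, 1, 2, 3, …}, 1 ≤ k ≤ c(j)}`. -/
def Idx : Type :=
  {p : ℤ × ℤ // (p.1 = -1 ∨ 1 ≤ p.1) ∧ 1 ≤ p.2 ∧ p.2 ≤ c p.1}

/-- The first coordinate `j` of an index `(j, k)`. -/
def Idx.j (i : Idx) : ℤ := i.1.1

/-- The index `(-1, 1)` of the real simple root. -/
def idxReal : Idx := ⟨(-1, 1), Or.inl rfl, le_refl 1, by simp [c_neg_one]⟩

/-- The index `(1, 1)`. -/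
def idxOne : Idx := ⟨(1, 1), Or.inr le_rfl, le_refl 1, by simp [c_one]⟩

/-- The Borcherds Cartan matrix `a_{jk,pq} = -(j + p)`. -/
def cartan (i p : Idx) : ℤ := -(i.j + p.j)

/-- The Serre--Chevalley generators. -/
inductive Gen : Type
  | e (i : Idx) : Gen
  | f (i : Idx) : Gen
  | h (i : Idx) : Gen

/-- The free complex Lie algebra on the Serre--Chevalley generators. -/
abbrev FreeL : Type := FreeLieAlgebra ℂ Gen

/-- The free generator `e_{jk}`. -/
def E (i : Idx) : FreeL := FreeLieAlgebra.of ℂ (Gen.e i)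
/-- The free generator `f_{jk}`. -/
def F (i : Idx) : FreeL := FreeLieAlgebra.of ℂ (Gen.f i)
/-- The free generator `h_{jk}`. -/
def H (i : Idx) : FreeL := FreeLieAlgebra.of ℂ (Gen.h i)

/-- The defining relations of `𝔤(A)`: `IsRelator r` means that `r = 0` is imposed. -/
inductive IsRelator : FreeL → Prop
  | hh (i p : Idx) : IsRelator ⁅H i, H p⁆
  | he (i p : Idx) : IsRelator (⁅H i, E p⁆ - (cartan i p : ℂ) • E p)
  | hf (i p : Idx) : IsRelator (⁅H i, F p⁆ + (cartan i p : ℂ) • F p)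
  | ef_same (i : Idx) : IsRelator (⁅E i, F i⁆ - H i)
  | ef_ne (i p : Idx) (hip : i ≠ p) : IsRelator ⁅E i, F p⁆
  | serre_e (i : Idx) (hi : 1 ≤ i.j) :
      IsRelator ((LieAlgebra.ad ℂ FreeL (E idxReal) ^ i.j.toNat) (E i))
  | serre_f (i : Idx) (hi : 1 ≤ i.j) :
      IsRelator ((LieAlgebra.ad ℂ FreeL (F idxReal) ^ i.j.toNat) (F i))

/-- The ideal of the free Lie algebra generated by the defining relations. -/
def relIdeal : LieIdeal ℂ FreeL := LieSubmodule.lieSpan ℂ FreeL {r | IsRelator r}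

/-- The Lie algebra `𝔤(A)`. -/
def BorcherdsAlgebra : Type := FreeL ⧸ relIdeal

instance : LieRing BorcherdsAlgebra := inferInstanceAs (LieRing (FreeL ⧸ relIdeal))
instance : LieAlgebra ℂ BorcherdsAlgebra := inferInstanceAs (LieAlgebra ℂ (FreeL ⧸ relIdeal))

/-- The Monster Lie algebra `𝔪 = 𝔤(A) / 𝔷`, with `𝔷` the center of `𝔤(A)`. -/
def Monster : Type := BorcherdsAlgebra ⧸ LieAlgebra.center ℂ BorcherdsAlgebra

instance : LieRing Monster :=
  inferInstanceAs (LieRing (BorcherdsAlgebra ⧸ LieAlgebra.center ℂ BorcherdsAlgebra))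
instance : LieAlgebra ℂ Monster :=
  inferInstanceAs (LieAlgebra ℂ (BorcherdsAlgebra ⧸ LieAlgebra.center ℂ BorcherdsAlgebra))

/-- The quotient map from the free Lie algebra to `𝔤(A)`. -/
def toBorcherds : FreeL →ₗ⁅ℂ⁆ BorcherdsAlgebra where
  toFun x := LieSubmodule.Quotient.mk' relIdeal x
  map_add' x y := map_add _ x y
  map_smul' a x := map_smul _ a x
  map_lie' {x y} := LieSubmodule.Quotient.mk_bracket (I := relIdeal) x y

/-- The quotient map from `𝔤(A)` to `𝔪`. -/
def fromBorcherds : BorcherdsAlgebra →ₗ⁅ℂ⁆ Monster where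
  toFun x := LieSubmodule.Quotient.mk' (LieAlgebra.center ℂ BorcherdsAlgebra) x
  map_add' x y := map_add _ x y
  map_smul' a x := map_smul _ a x
  map_lie' {x y} :=
    LieSubmodule.Quotient.mk_bracket (I := LieAlgebra.center ℂ BorcherdsAlgebra) x y

/-- The quotient map from the free Lie algebra to `𝔪`. -/
def toMonster : FreeL →ₗ⁅ℂ⁆ Monster := fromBorcherds.comp toBorcherds

theorem toMonster_surjective : Function.Surjective toMonster := by
  intro x
  obtain ⟨y, rfl⟩ := LieSubmodule.Quotient.surjective_mk' _ x
  obtain ⟨z, rfl⟩ := LieSubmodule.Quotient.surjective_mk' relIdeal y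
  exact ⟨z, rfl⟩

theorem toMonster_relator {r : FreeL} (hr : IsRelator r) : toMonster r = 0 := by
  have : toBorcherds r = 0 :=
    (LieSubmodule.Quotient.mk_eq_zero (N := relIdeal)).2 (LieSubmodule.subset_lieSpan hr)
  simp [toMonster, this]

/-- The image of `e_{jk}` in `𝔪`. -/
def e (i : Idx) : Monster := toMonster (E i)
/-- The image of `f_{jk}` in `𝔪`. -/
def f (i : Idx) : Monster := toMonster (F i)
/-- The image of `h_{jk}` in `𝔪`. -/
def h (i : Idx) : Monster := toMonster (H i)

/-- `h₁ = (h_{-1,1} - h_{1,1}) / 2` in `𝔪`. -/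
def h₁ : Monster := (1 / 2 : ℂ) • (h idxReal - h idxOne)
/-- `h₂ = -(h_{-1,1} + h_{1,1}) / 2` in `𝔪`. -/
def h₂ : Monster := -((1 / 2 : ℂ) • (h idxReal + h idxOne))

/-- The subalgebra `𝔤𝔩₂(-1)` of `𝔪` generated by `e₋₁, f₋₁, h₁, h₂`. -/
def gl2 : LieSubalgebra ℂ Monster :=
  LieSubalgebra.lieSpan ℂ Monster {e idxReal, f idxReal, h₁, h₂}

/-- The root space `𝔪_{(a,b)}` with respect to the Cartan subalgebra `𝔥 = ℂ h₁ ⊕ ℂ h₂`, where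
`(a,b) ∈ II_{1,1} = ℤ ⊕ ℤ` is the functional with `h₁ ↦ a`, `h₂ ↦ b`. -/
def rootSpace (a b : ℤ) : Submodule ℂ Monster where
  carrier := {x | ⁅h₁, x⁆ = (a : ℂ) • x ∧ ⁅h₂, x⁆ = (b : ℂ) • x}
  add_mem' := by
    rintro x y ⟨hx, hx'⟩ ⟨hy, hy'⟩
    exact ⟨by rw [lie_add, hx, hy, smul_add], by rw [lie_add, hx', hy', smul_add]⟩
  zero_mem' := ⟨by simp, by simp⟩
  smul_mem' := by
    rintro t x ⟨hx, hx'⟩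
    exact ⟨by rw [lie_smul, hx, smul_comm], by rw [lie_smul, hx', smul_comm]⟩

/-- `⨁ 𝔪_{(a,b)}`, the sum being over all `(a,b)` with `a + b = k`. -/
def weightSum (k : ℤ) : Submodule ℂ Monster :=
  ⨆ a : ℤ, rootSpace a (k - a)

/-- The component `𝔪_k` of the `ℤ`-grading of `𝔪`: the sum of the root spaces `𝔪_{(a,b)}` with
`a + b = k` if `k ≠ 0`, and `𝔤𝔩₂(-1)` if `k = 0`. -/
def piece (k : ℤ) : Submodule ℂ Monster :=
  if k = 0 then gl2.toSubmodule else weightSum k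

theorem lie_mem_rootSpace {a b a' b' : ℤ} {x y : Monster} (hx : x ∈ rootSpace a b)
    (hy : y ∈ rootSpace a' b') : ⁅x, y⁆ ∈ rootSpace (a + a') (b + b') := by
  obtain ⟨h1, h2⟩ := hx
  obtain ⟨h3, h4⟩ := hy
  constructor
  · rw [leibniz_lie, h1, h3, lie_smul, smul_lie, ← add_smul]; push_cast; rfl
  · rw [leibniz_lie, h2, h4, lie_smul, smul_lie, ← add_smul]; push_cast; rfl

theorem lie_mem_weightSum {k l : ℤ} {x y : Monster} (hx : x ∈ weightSum k)
    (hy : y ∈ weightSum l) : ⁅x, y⁆ ∈ weightSum (k + l) := by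
  unfold weightSum at hx
  induction hx using Submodule.iSup_induction' with
  | zero => simp
  | add x x' _ _ ihx ihx' => rw [add_lie]; exact add_mem ihx ihx'
  | mem a x hx =>
    unfold weightSum at hy
    induction hy using Submodule.iSup_induction' with
    | zero => simp
    | add y y' _ _ ihx ihx' => rw [lie_add]; exact add_mem ihx ihx'
    | mem b y hy =>
      have := lie_mem_rootSpace hx hy
      rw [show k - a + (l - b) = k + l - (a + b) by ring] at this
      exact Submodule.mem_iSup_of_mem (a + b) this

theorem h_e (i p : Idx) : ⁅h i, e p⁆ = (cartan i p : ℂ) • e p := by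
  have := toMonster_relator (IsRelator.he i p)
  rw [map_sub, map_smul, LieHom.map_lie, sub_eq_zero] at this
  exact this

theorem h_f (i p : Idx) : ⁅h i, f p⁆ = -((cartan i p : ℂ) • f p) := by
  have := toMonster_relator (IsRelator.hf i p)
  rw [map_add, map_smul, LieHom.map_lie, add_eq_zero_iff_eq_neg] at this
  exact this

theorem h_h (i p : Idx) : ⁅h i, h p⁆ = 0 := by
  have := toMonster_relator (IsRelator.hh i p)
  rwa [LieHom.map_lie] at this

theorem e_f_same (i : Idx) : ⁅e i, f i⁆ = h i := by
  have := toMonster_relator (IsRelator.ef_same i)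
  rwa [map_sub, LieHom.map_lie, sub_eq_zero] at this

theorem e_f_ne {i p : Idx} (hip : i ≠ p) : ⁅e i, f p⁆ = 0 := by
  have := toMonster_relator (IsRelator.ef_ne i p hip)
  rwa [LieHom.map_lie] at this

theorem e_mem (p : Idx) : e p ∈ rootSpace 1 p.j := by
  constructor
  · rw [h₁, smul_lie, sub_lie, h_e, h_e, ← sub_smul, smul_smul]
    congr 1
    simp [cartan, Idx.j, idxReal, idxOne]; ring
  · rw [h₂, neg_lie, smul_lie, add_lie, h_e, h_e, ← add_smul, smul_smul, ← neg_smul]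
    congr 1
    simp [cartan, Idx.j, idxReal, idxOne]; ring

theorem f_mem (p : Idx) : f p ∈ rootSpace (-1) (-p.j) := by
  constructor
  · rw [h₁, smul_lie, sub_lie, h_f, h_f, neg_sub_neg, ← sub_smul, smul_smul]
    congr 1
    simp [cartan, Idx.j, idxReal, idxOne]; ring
  · rw [h₂, neg_lie, smul_lie, add_lie, h_f, h_f, ← neg_add, ← add_smul, smul_neg, neg_neg,
      smul_smul]
    congr 1
    simp [cartan, Idx.j, idxReal, idxOne]; ring

theorem h_mem (p : Idx) : h p ∈ rootSpace 0 0 := by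
  constructor <;> simp [h₁, h₂, h_h]


/-- The elements that map a subspace `M` into a subspace closed under them form a subalgebra. -/
def stabilizer {L : Type} [LieRing L] [LieAlgebra ℂ L] (M : Submodule ℂ L) : LieSubalgebra ℂ L where
  carrier := {t | ∀ m ∈ M, ⁅t, m⁆ ∈ M}
  add_mem' ha hb m hm := by rw [add_lie]; exact add_mem (ha m hm) (hb m hm)
  zero_mem' m hm := by simp
  smul_mem' r t ht m hm := by rw [smul_lie]; exact M.smul_mem r (ht m hm)
  lie_mem' {a b} ha hb m hm := by
    rw [lie_lie]; exact sub_mem (ha _ (hb m hm)) (hb _ (ha m hm))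

section Triangular

variable {L : Type} [LieRing L] [LieAlgebra ℂ L] {ι : Type}

/-- The span of the elements `(ad x)^l (u p)`. -/
def orbitSpan (x : L) (u : ι → L) : Submodule ℂ L :=
  Submodule.span ℂ (Set.range fun q : ℕ × ι => (LieAlgebra.ad ℂ L x ^ q.1) (u q.2))

theorem orbit_eigen {x : L} {u : ι → L} {t : L} (htx : ∃ a : ℂ, ⁅t, x⁆ = a • x)
    (htu : ∀ p, ∃ a : ℂ, ⁅t, u p⁆ = a • u p) (l : ℕ) (p : ι) :
    ∃ a : ℂ, ⁅t, (LieAlgebra.ad ℂ L x ^ l) (u p)⁆ = a • (LieAlgebra.ad ℂ L x ^ l) (u p) := by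
  induction l with
  | zero => simpa using htu p
  | succ l ih =>
    obtain ⟨a, ha⟩ := ih
    obtain ⟨b, hb⟩ := htx
    refine ⟨b + a, ?_⟩
    rw [pow_succ', Module.End.mul_apply, LieAlgebra.ad_apply, leibniz_lie, ha, hb, smul_lie,
      lie_smul, add_smul]

theorem gl_orbit {x y t₁ t₂ : L} {u : ι → L} {G : LieSubalgebra ℂ L}
    (hG : G = LieSubalgebra.lieSpan ℂ L {x, y, t₁, t₂})
    (hyu : ∀ p, ⁅y, u p⁆ = 0)
    (hyx : ∃ a b : ℂ, ⁅y, x⁆ = a • t₁ + b • t₂)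
    (h1x : ∃ a : ℂ, ⁅t₁, x⁆ = a • x) (h2x : ∃ a : ℂ, ⁅t₂, x⁆ = a • x)
    (h1u : ∀ p, ∃ a : ℂ, ⁅t₁, u p⁆ = a • u p) (h2u : ∀ p, ∃ a : ℂ, ⁅t₂, u p⁆ = a • u p) :
    G ≤ stabilizer (orbitSpan x u) := by
  have key : ∀ t : L, (∀ (l : ℕ) (p : ι),
      ⁅t, (LieAlgebra.ad ℂ L x ^ l) (u p)⁆ ∈ orbitSpan x u) → t ∈ stabilizer (orbitSpan x u) := by
    intro t ht m hm
    unfold orbitSpan at hm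
    induction hm using Submodule.span_induction with
    | mem m hm => obtain ⟨⟨l, p⟩, rfl⟩ := hm; exact ht l p
    | zero => simp
    | add a b _ _ ha hb => rw [lie_add]; exact add_mem ha hb
    | smul r a _ ha => rw [lie_smul]; exact Submodule.smul_mem _ r ha
  have hmem : ∀ l p, (LieAlgebra.ad ℂ L x ^ l) (u p) ∈ orbitSpan x u := fun l p =>
    Submodule.subset_span ⟨(l, p), rfl⟩
  have hx : x ∈ stabilizer (orbitSpan x u) := by
    refine key x fun l p => ?_
    have := hmem (l + 1) p
    rwa [pow_succ', Module.End.mul_apply, LieAlgebra.ad_apply] at this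
  have h1 : t₁ ∈ stabilizer (orbitSpan x u) := by
    refine key _ fun l p => ?_
    obtain ⟨a, ha⟩ := orbit_eigen h1x h1u l p
    rw [ha]; exact Submodule.smul_mem _ a (hmem l p)
  have h2 : t₂ ∈ stabilizer (orbitSpan x u) := by
    refine key _ fun l p => ?_
    obtain ⟨a, ha⟩ := orbit_eigen h2x h2u l p
    rw [ha]; exact Submodule.smul_mem _ a (hmem l p)
  have hy : y ∈ stabilizer (orbitSpan x u) := by
    refine key y fun l p => ?_
    induction l with
    | zero => simp [hyu]
    | succ l ih =>
      rw [pow_succ', Module.End.mul_apply, LieAlgebra.ad_apply, leibniz_lie]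
      refine add_mem ?_ (hx _ ih)
      obtain ⟨a, b, hab⟩ := hyx
      rw [hab]
      exact (add_mem ((stabilizer (orbitSpan x u)).smul_mem a h1)
        ((stabilizer (orbitSpan x u)).smul_mem b h2)) _ (hmem l p)
  rw [hG, LieSubalgebra.lieSpan_le]
  rintro z (rfl | rfl | rfl | rfl) <;> assumption

theorem gl_nil {M : Submodule ℂ L} {G : LieSubalgebra ℂ L} (hGM : G ≤ stabilizer M) :
    G ≤ stabilizer (LieSubalgebra.lieSpan ℂ L (M : Set L)).toSubmodule := by
  intro t ht m hm
  simp only [LieSubalgebra.mem_toSubmodule] at hm ⊢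
  induction hm using LieSubalgebra.lieSpan_induction with
  | mem m hm => exact LieSubalgebra.subset_lieSpan (hGM ht m hm)
  | zero => simp
  | add a b _ _ ha hb => rw [lie_add]; exact add_mem ha hb
  | smul r a _ ha => rw [lie_smul]; exact LieSubalgebra.smul_mem _ r ha
  | lie a b ha' hb' ha hb =>
    rw [leibniz_lie]
    exact add_mem (LieSubalgebra.lie_mem _ ha hb') (LieSubalgebra.lie_mem _ ha' hb)

theorem lower_nil {x : L} {u : ι → L} {G : LieSubalgebra ℂ L} (hxG : x ∈ G)
    (hGM : G ≤ stabilizer (orbitSpan x u)) {v : L} (hxv : ⁅x, v⁆ = 0)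
    (huv : ∀ p, ⁅v, u p⁆ ∈ G) :
    ∀ m ∈ LieSubalgebra.lieSpan ℂ L (orbitSpan x u : Set L),
      ⁅v, m⁆ ∈ G.toSubmodule ⊔
        (LieSubalgebra.lieSpan ℂ L (orbitSpan x u : Set L)).toSubmodule := by
  have hvx : ⁅v, x⁆ = 0 := by rw [← lie_skew, hxv, neg_zero]
  have h0 : ∀ (l : ℕ) (p : ι), ⁅v, (LieAlgebra.ad ℂ L x ^ l) (u p)⁆ ∈ G := by
    intro l p
    induction l with
    | zero => simpa using huv p
    | succ l ih =>
      rw [pow_succ', Module.End.mul_apply, LieAlgebra.ad_apply, leibniz_lie, hvx, zero_lie, zero_add]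
      exact G.lie_mem hxG ih
  have h1 : ∀ m ∈ orbitSpan x u, ⁅v, m⁆ ∈ G := by
    intro m hm
    unfold orbitSpan at hm
    induction hm using Submodule.span_induction with
    | mem m hm => obtain ⟨⟨l, p⟩, rfl⟩ := hm; exact h0 l p
    | zero => simp
    | add a b _ _ ha hb => rw [lie_add]; exact add_mem ha hb
    | smul r a _ ha => rw [lie_smul]; exact G.smul_mem r ha
  have hst := gl_nil hGM
  intro m hm
  induction hm using LieSubalgebra.lieSpan_induction with
  | mem m hm => exact Submodule.mem_sup_left (h1 m hm)
  | zero => simp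
  | add a b _ _ ha hb => rw [lie_add]; exact add_mem ha hb
  | smul r a _ ha => rw [lie_smul]; exact Submodule.smul_mem _ r ha
  | lie a b ha' hb' ha hb =>
    have aux : ∀ s ∈ G.toSubmodule ⊔
        (LieSubalgebra.lieSpan ℂ L (orbitSpan x u : Set L)).toSubmodule,
        ∀ n ∈ LieSubalgebra.lieSpan ℂ L (orbitSpan x u : Set L),
        ⁅s, n⁆ ∈ LieSubalgebra.lieSpan ℂ L (orbitSpan x u : Set L) := by
      intro s hs n hn
      obtain ⟨g, hg, m', hm', rfl⟩ := Submodule.mem_sup.1 hs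
      rw [add_lie]
      exact add_mem (hst hg n hn) (LieSubalgebra.lie_mem _ hm' hn)
    rw [leibniz_lie]
    refine Submodule.mem_sup_right (add_mem (aux _ ha b hb') ?_)
    rw [← lie_skew]
    exact neg_mem (aux _ hb a ha')

end Triangular

theorem free_generated (S : LieSubalgebra ℂ FreeL) (hS : ∀ g, FreeLieAlgebra.of ℂ g ∈ S)
    (x : FreeL) : x ∈ S := by
  let φ : FreeL →ₗ⁅ℂ⁆ S := FreeLieAlgebra.lift ℂ fun g => ⟨FreeLieAlgebra.of ℂ g, hS g⟩
  have : S.incl.comp φ = LieHom.id := by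
    apply FreeLieAlgebra.hom_ext
    intro g
    simp [φ]
  have hx : S.incl (φ x) = x := LieHom.congr_fun this x
  rw [← hx]
  exact (φ x).2

theorem h_eq (i : Idx) : h i = -((i.j : ℂ) • h₁ + h₂) := by
  set z : FreeL := H i + ((i.j : ℂ) • ((1 / 2 : ℂ) • (H idxReal - H idxOne)) +
    -((1 / 2 : ℂ) • (H idxReal + H idxOne))) with hz
  have rel : ∀ {r : FreeL}, IsRelator r → toBorcherds r = 0 := fun hr =>
    (LieSubmodule.Quotient.mk_eq_zero (N := relIdeal)).2 (LieSubmodule.subset_lieSpan hr)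
  have he : ∀ i p, ⁅toBorcherds (H i), toBorcherds (E p)⁆ = (cartan i p : ℂ) • toBorcherds (E p) := by
    intro i p
    have := rel (IsRelator.he i p)
    rwa [map_sub, map_smul, LieHom.map_lie, sub_eq_zero] at this
  have hf : ∀ i p, ⁅toBorcherds (H i), toBorcherds (F p)⁆ = (-(cartan i p : ℂ)) • toBorcherds (F p) := by
    intro i p
    have := rel (IsRelator.hf i p)
    rwa [map_add, map_smul, LieHom.map_lie, add_eq_zero_iff_eq_neg, ← neg_smul] at this
  have hh : ∀ i p, ⁅toBorcherds (H i), toBorcherds (H p)⁆ = 0 := by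
    intro i p
    have := rel (IsRelator.hh i p)
    rwa [LieHom.map_lie] at this
  have hcentral : ∀ w : FreeL, ⁅toBorcherds w, toBorcherds z⁆ = 0 := by
    have hgen : ∀ g : Gen, ⁅toBorcherds z, toBorcherds (FreeLieAlgebra.of ℂ g)⁆ = 0 := by
      intro g
      rw [hz]
      simp only [map_add, map_smul, map_neg, map_sub, add_lie, smul_lie, neg_lie, sub_lie]
      rcases g with p | p | p
      · change ⁅toBorcherds (H i), toBorcherds (E p)⁆ + ((i.j : ℂ) • (1 / 2 : ℂ) •
          (⁅toBorcherds (H idxReal), toBorcherds (E p)⁆ - ⁅toBorcherds (H idxOne), toBorcherds (E p)⁆)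
          + -((1 / 2 : ℂ) • (⁅toBorcherds (H idxReal), toBorcherds (E p)⁆ +
            ⁅toBorcherds (H idxOne), toBorcherds (E p)⁆))) = 0
        simp only [he, cartan]
        match_scalars
        simp [Idx.j, idxReal, idxOne]; ring
      · change ⁅toBorcherds (H i), toBorcherds (F p)⁆ + ((i.j : ℂ) • (1 / 2 : ℂ) •
          (⁅toBorcherds (H idxReal), toBorcherds (F p)⁆ - ⁅toBorcherds (H idxOne), toBorcherds (F p)⁆)
          + -((1 / 2 : ℂ) • (⁅toBorcherds (H idxReal), toBorcherds (F p)⁆ +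
            ⁅toBorcherds (H idxOne), toBorcherds (F p)⁆))) = 0
        simp only [hf, cartan]
        match_scalars
        simp [Idx.j, idxReal, idxOne]; ring
      · change ⁅toBorcherds (H i), toBorcherds (H p)⁆ + ((i.j : ℂ) • (1 / 2 : ℂ) •
          (⁅toBorcherds (H idxReal), toBorcherds (H p)⁆ - ⁅toBorcherds (H idxOne), toBorcherds (H p)⁆)
          + -((1 / 2 : ℂ) • (⁅toBorcherds (H idxReal), toBorcherds (H p)⁆ +
            ⁅toBorcherds (H idxOne), toBorcherds (H p)⁆))) = 0
        simp [hh]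
    let S : LieSubalgebra ℂ FreeL :=
      { carrier := {w | ⁅toBorcherds w, toBorcherds z⁆ = 0}
        add_mem' := by
          intro a b (ha : _ = _) (hb : _ = _)
          change ⁅toBorcherds (a + b), toBorcherds z⁆ = 0
          rw [map_add, add_lie, ha, hb, add_zero]
        zero_mem' := by
          change ⁅toBorcherds 0, toBorcherds z⁆ = 0
          rw [map_zero, zero_lie]
        smul_mem' := by
          intro r a (ha : _ = _)
          change ⁅toBorcherds (r • a), toBorcherds z⁆ = 0
          rw [map_smul, smul_lie, ha, smul_zero]
        lie_mem' := by
          intro a b (ha : _ = _) (hb : _ = _)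
          change ⁅toBorcherds ⁅a, b⁆, toBorcherds z⁆ = 0
          rw [LieHom.map_lie, lie_lie, ha, hb, lie_zero, lie_zero, sub_zero] }
    intro w
    refine free_generated S (fun g => ?_) w
    change ⁅toBorcherds _, toBorcherds z⁆ = 0
    rw [← lie_skew, hgen g, neg_zero]
  have h0 : toMonster z = 0 := by
    refine (LieSubmodule.Quotient.mk_eq_zero (N := LieAlgebra.center ℂ BorcherdsAlgebra)).2 ?_
    rw [LieModule.mem_maxTrivSubmodule]
    intro w
    obtain ⟨w, rfl⟩ := LieSubmodule.Quotient.surjective_mk' relIdeal w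
    exact hcentral w
  rw [hz] at h0
  simp only [map_add, map_smul, map_neg, map_sub] at h0
  exact eq_neg_of_add_eq_zero_left h0

theorem monster_generated (S : LieSubalgebra ℂ Monster)
    (he : ∀ i, e i ∈ S) (hf : ∀ i, f i ∈ S) (hh : ∀ i, h i ∈ S) (x : Monster) : x ∈ S := by
  obtain ⟨w, rfl⟩ := toMonster_surjective x
  refine free_generated (S.comap toMonster) (fun g => ?_) w
  rw [LieSubalgebra.mem_comap]
  rcases g with i | i | i
  exacts [he i, hf i, hh i]

/-- The indices of the imaginary simple roots. -/
abbrev ImIdx : Type := {i : Idx // 1 ≤ i.j}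

/-- The subalgebra generated by the `(ad e₋₁)^l e_{jk}` with `j ≥ 1`. -/
def nilPos : LieSubalgebra ℂ Monster :=
  LieSubalgebra.lieSpan ℂ Monster (orbitSpan (e idxReal) fun p : ImIdx => e p.1)

/-- The subalgebra generated by the `(ad f₋₁)^l f_{jk}` with `j ≥ 1`. -/
def nilNeg : LieSubalgebra ℂ Monster :=
  LieSubalgebra.lieSpan ℂ Monster (orbitSpan (f idxReal) fun p : ImIdx => f p.1)

theorem Idx.eq_real_or (i : Idx) : i = idxReal ∨ 1 ≤ i.j := by
  obtain ⟨⟨a, b⟩, h1, h2, h3⟩ := i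
  rcases h1 with h1 | h1
  · left
    simp only at h1
    subst h1
    simp only [c_neg_one] at h2 h3
    have : b = 1 := le_antisymm h3 h2
    subst this
    rfl
  · right; exact h1

theorem im_ne_real (p : ImIdx) : p.1 ≠ idxReal := by
  intro hp
  have := p.2
  rw [hp] at this
  simp [Idx.j, idxReal] at this

theorem e_real_mem : e idxReal ∈ gl2 := LieSubalgebra.subset_lieSpan (by simp)
theorem f_real_mem : f idxReal ∈ gl2 := LieSubalgebra.subset_lieSpan (by simp)
theorem h₁_mem : h₁ ∈ gl2 := LieSubalgebra.subset_lieSpan (by simp)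
theorem h₂_mem : h₂ ∈ gl2 := LieSubalgebra.subset_lieSpan (by simp)

theorem h_mem_gl2 (i : Idx) : h i ∈ gl2 := by
  rw [h_eq]
  exact neg_mem (add_mem (gl2.smul_mem _ h₁_mem) h₂_mem)

theorem h_real : h idxReal = h₁ - h₂ := by
  rw [h_eq]
  simp only [Idx.j, idxReal]
  push_cast
  module

theorem gl2_pos : gl2 ≤ stabilizer (orbitSpan (e idxReal) fun p : ImIdx => e p.1) := by
  refine gl_orbit (y := f idxReal) (t₁ := h₁) (t₂ := h₂) rfl ?_ ?_ ⟨_, (e_mem _).1⟩ ⟨_, (e_mem _).2⟩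
    (fun p => ⟨_, (e_mem _).1⟩) (fun p => ⟨_, (e_mem _).2⟩)
  · intro p
    rw [← lie_skew, e_f_ne (im_ne_real p), neg_zero]
  · refine ⟨-1, 1, ?_⟩
    rw [← lie_skew, e_f_same, h_real]
    module

theorem gl2_neg : gl2 ≤ stabilizer (orbitSpan (f idxReal) fun p : ImIdx => f p.1) := by
  refine gl_orbit (y := e idxReal) (t₁ := h₁) (t₂ := h₂) ?_ ?_ ?_ ⟨_, (f_mem _).1⟩ ⟨_, (f_mem _).2⟩
    (fun p => ⟨_, (f_mem _).1⟩) (fun p => ⟨_, (f_mem _).2⟩)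
  · rw [gl2, Set.insert_comm]
  · intro p
    rw [e_f_ne (im_ne_real p).symm]
  · refine ⟨1, -1, ?_⟩
    rw [e_f_same, h_real]
    module

theorem e_f_mem_gl2 (i p : Idx) : ⁅e i, f p⁆ ∈ gl2 := by
  by_cases hip : i = p
  · rw [hip, e_f_same]; exact h_mem_gl2 p
  · rw [e_f_ne hip]; exact gl2.zero_mem

theorem e_mem_nilPos (p : ImIdx) : e p.1 ∈ nilPos :=
  LieSubalgebra.subset_lieSpan (Submodule.subset_span ⟨(0, p), by simp⟩)

theorem f_mem_nilNeg (p : ImIdx) : f p.1 ∈ nilNeg :=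
  LieSubalgebra.subset_lieSpan (Submodule.subset_span ⟨(0, p), by simp⟩)

/-- The triangular decomposition of `𝔪`. -/
theorem triangular (x : Monster) :
    x ∈ nilNeg.toSubmodule ⊔ (gl2.toSubmodule ⊔ nilPos.toSubmodule) := by
  set S := nilNeg.toSubmodule ⊔ (gl2.toSubmodule ⊔ nilPos.toSubmodule) with hS
  have hN : nilNeg.toSubmodule ≤ S := le_sup_left
  have hG : gl2.toSubmodule ≤ S := le_sup_left.trans le_sup_right
  have hP : nilPos.toSubmodule ≤ S := le_sup_right.trans le_sup_right
  have key : ∀ t : Monster, (∀ m ∈ nilNeg, ⁅t, m⁆ ∈ S) → (∀ m ∈ gl2, ⁅t, m⁆ ∈ S) →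
      (∀ m ∈ nilPos, ⁅t, m⁆ ∈ S) → t ∈ stabilizer S := by
    intro t h1 h2 h3 m hm
    obtain ⟨a, ha, y, hy, rfl⟩ := Submodule.mem_sup.1 hm
    obtain ⟨b, hb, d, hd, rfl⟩ := Submodule.mem_sup.1 hy
    rw [lie_add, lie_add]
    exact add_mem (h1 a ha) (add_mem (h2 b hb) (h3 d hd))
  have hgl : ∀ t ∈ gl2, t ∈ stabilizer S := fun t ht =>
    key t (fun m hm => hN (gl_nil gl2_neg ht m hm)) (fun m hm => hG (gl2.lie_mem ht hm))
      (fun m hm => hP (gl_nil gl2_pos ht m hm))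
  have he : ∀ i, e i ∈ stabilizer S := by
    intro i
    rcases i.eq_real_or with rfl | hi
    · exact hgl _ e_real_mem
    · refine key _ (fun m hm => ?_) (fun m hm => ?_) (fun m hm => ?_)
      · refine (sup_le hG hN) (lower_nil f_real_mem gl2_neg ?_ (fun p => e_f_mem_gl2 _ _) m hm)
        rw [← lie_skew, e_f_ne (im_ne_real ⟨i, hi⟩), neg_zero]
      · rw [← lie_skew]
        exact neg_mem (hP (gl_nil gl2_pos hm _ (e_mem_nilPos ⟨i, hi⟩)))
      · exact hP (nilPos.lie_mem (e_mem_nilPos ⟨i, hi⟩) hm)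
  have hf : ∀ i, f i ∈ stabilizer S := by
    intro i
    rcases i.eq_real_or with rfl | hi
    · exact hgl _ f_real_mem
    · refine key _ (fun m hm => ?_) (fun m hm => ?_) (fun m hm => ?_)
      · exact hN (nilNeg.lie_mem (f_mem_nilNeg ⟨i, hi⟩) hm)
      · rw [← lie_skew]
        exact neg_mem (hN (gl_nil gl2_neg hm _ (f_mem_nilNeg ⟨i, hi⟩)))
      · refine (sup_le hG hP) (lower_nil e_real_mem gl2_pos ?_ (fun p => ?_) m hm)
        · exact e_f_ne (im_ne_real ⟨i, hi⟩).symm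
        · rw [← lie_skew]; exact neg_mem (e_f_mem_gl2 _ _)
  have hst : ∀ t, t ∈ stabilizer S :=
    monster_generated _ he hf fun i => hgl _ (h_mem_gl2 i)
  refine monster_generated { S with lie_mem' := fun {a b} _ hb => hst a b hb } ?_ ?_ ?_ x
  · intro i
    rcases i.eq_real_or with rfl | hi
    · exact hG e_real_mem
    · exact hP (e_mem_nilPos ⟨i, hi⟩)
  · intro i
    rcases i.eq_real_or with rfl | hi
    · exact hG f_real_mem
    · exact hN (f_mem_nilNeg ⟨i, hi⟩)
  · intro i
    exact hG (h_mem_gl2 i)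

theorem rootSpace_le (a b : ℤ) : rootSpace a b ≤ weightSum (a + b) := by
  intro x hx
  refine Submodule.mem_iSup_of_mem a ?_
  rwa [show a + b - a = b by ring]

theorem weightSum_le (k : ℤ) :
    weightSum k ≤ Module.End.eigenspace (LieAlgebra.ad ℂ Monster (h₁ + h₂)) (k : ℂ) := by
  refine iSup_le fun a x hx => ?_
  rw [Module.End.mem_eigenspace_iff, LieAlgebra.ad_apply, add_lie, hx.1, hx.2, ← add_smul]
  push_cast
  congr 1
  ring

theorem gl2_le : gl2.toSubmodule ≤ weightSum 0 := by
  let W : LieSubalgebra ℂ Monster :=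
    { weightSum 0 with lie_mem' := fun {a b} ha hb => by simpa using lie_mem_weightSum ha hb }
  have : gl2 ≤ W := by
    rw [gl2, LieSubalgebra.lieSpan_le]
    have hj : idxReal.j = -1 := rfl
    have he : e idxReal ∈ weightSum 0 := by
      have := rootSpace_le _ _ (e_mem idxReal)
      rwa [hj, show (1 : ℤ) + -1 = 0 by norm_num] at this
    have hf : f idxReal ∈ weightSum 0 := by
      have := rootSpace_le _ _ (f_mem idxReal)
      rwa [hj, show (-1 : ℤ) + - -1 = 0 by norm_num] at this
    have hh : ∀ p, h p ∈ weightSum 0 := fun p => by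
      have := rootSpace_le _ _ (h_mem p)
      rwa [add_zero] at this
    have h1 : h₁ ∈ weightSum 0 := Submodule.smul_mem _ _ (sub_mem (hh _) (hh _))
    have h2 : h₂ ∈ weightSum 0 := neg_mem (Submodule.smul_mem _ _ (add_mem (hh _) (hh _)))
    rintro z (rfl | rfl | rfl | rfl)
    exacts [he, hf, h1, h2]
  exact this

/-- The sum of the graded components of nonzero degree. -/
def nonzeroSum : Submodule ℂ Monster := ⨆ (k : ℤ) (_ : k ≠ 0), weightSum k

/-- Closure of a half of the grading under brackets, used for both signs `s = ±1`. -/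
theorem lieSpan_le_half (s : ℤ) (A : Set Monster)
    (hA : ∀ a ∈ A, a ∈ ⨆ (n : ℕ), weightSum (s * (n + 1))) :
    (LieSubalgebra.lieSpan ℂ Monster A).toSubmodule ≤ ⨆ (n : ℕ), weightSum (s * (n + 1)) := by
  intro x hx
  rw [LieSubalgebra.mem_toSubmodule] at hx
  induction hx using LieSubalgebra.lieSpan_induction with
  | mem x hx => exact hA x hx
  | zero => simp
  | add a b _ _ ha hb => exact add_mem ha hb
  | smul r a _ ha => exact Submodule.smul_mem _ r ha
  | lie a b ha' hb' ha hb =>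
    clear ha' hb'
    induction ha using Submodule.iSup_induction' with
    | zero => simp
    | add a a' _ _ iha iha' => rw [add_lie]; exact add_mem iha iha'
    | mem m a ha =>
      induction hb using Submodule.iSup_induction' with
      | zero => simp
      | add b b' _ _ ihb ihb' => rw [lie_add]; exact add_mem ihb ihb'
      | mem n b hb =>
        refine Submodule.mem_iSup_of_mem (m + n + 1) ?_
        have := lie_mem_weightSum ha hb
        convert this using 2
        push_cast; ring

theorem half_le {s : ℤ} (hs : s ≠ 0) : (⨆ (n : ℕ), weightSum (s * (n + 1))) ≤ nonzeroSum := by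
  refine iSup_le fun n => ?_
  refine le_iSup₂_of_le (s * (n + 1)) ?_ le_rfl
  exact mul_ne_zero hs (by positivity)

theorem ad_pow_mem {x u : Monster} {k : ℤ} (hx : x ∈ weightSum 0) (hu : u ∈ weightSum k) (l : ℕ) :
    (LieAlgebra.ad ℂ Monster x ^ l) u ∈ weightSum k := by
  induction l with
  | zero => simpa using hu
  | succ l ih =>
    rw [pow_succ', Module.End.mul_apply, LieAlgebra.ad_apply]
    simpa using lie_mem_weightSum hx ih

theorem nilPos_le : nilPos.toSubmodule ≤ nonzeroSum := by
  refine (lieSpan_le_half 1 _ ?_).trans (half_le one_ne_zero)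
  suffices hle : orbitSpan (e idxReal) (fun p : ImIdx => e p.1) ≤
      ⨆ (n : ℕ), weightSum (1 * (n + 1)) from fun a ha => hle ha
  rw [orbitSpan, Submodule.span_le]
  rintro _ ⟨⟨l, p⟩, rfl⟩
  have h1 := rootSpace_le _ _ (e_mem p.1)
  have hp := p.2
  refine Submodule.mem_iSup_of_mem p.1.j.toNat ?_
  refine ad_pow_mem (gl2_le e_real_mem) ?_ l
  convert h1 using 2
  rw [Int.toNat_of_nonneg (by lia)]; ring

theorem nilNeg_le : nilNeg.toSubmodule ≤ nonzeroSum := by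
  refine (lieSpan_le_half (-1) _ ?_).trans (half_le (by norm_num))
  suffices hle : orbitSpan (f idxReal) (fun p : ImIdx => f p.1) ≤
      ⨆ (n : ℕ), weightSum (-1 * (n + 1)) from fun a ha => hle ha
  rw [orbitSpan, Submodule.span_le]
  rintro _ ⟨⟨l, p⟩, rfl⟩
  have h1 := rootSpace_le _ _ (f_mem p.1)
  have hp := p.2
  refine Submodule.mem_iSup_of_mem p.1.j.toNat ?_
  refine ad_pow_mem (gl2_le f_real_mem) ?_ l
  convert h1 using 2
  rw [Int.toNat_of_nonneg (by lia)]; ring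

/-- The degree-zero part of `𝔪` is `𝔤𝔩₂(-1)`. -/
theorem weightSum_zero : weightSum 0 = gl2.toSubmodule := by
  refine le_antisymm (fun x hx => ?_) gl2_le
  obtain ⟨a, ha, y, hy, rfl⟩ := Submodule.mem_sup.1 (triangular x)
  obtain ⟨b, hb, d, hd, rfl⟩ := Submodule.mem_sup.1 hy
  have h1 : a + d ∈ nonzeroSum := add_mem (nilNeg_le ha) (nilPos_le hd)
  have h2 : a + d ∈ weightSum 0 := by
    have := sub_mem hx (gl2_le hb)
    rwa [show a + (b + d) - b = a + d by abel] at this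
  have hind := Module.End.eigenspaces_iSupIndep (LieAlgebra.ad ℂ Monster (h₁ + h₂)) (0 : ℂ)
  have h3 : a + d ∈ ⨆ (μ : ℂ) (_ : μ ≠ 0),
      Module.End.eigenspace (LieAlgebra.ad ℂ Monster (h₁ + h₂)) μ := by
    refine (iSup₂_le fun k hk => ?_ : nonzeroSum ≤ _) h1
    exact le_iSup₂_of_le (k : ℂ) (by exact_mod_cast hk) (weightSum_le k)
  have h4 := Submodule.disjoint_def.1 hind (a + d) (by simpa using weightSum_le 0 h2) h3
  rw [show a + (b + d) = b + (a + d) by abel, h4, add_zero]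
  exact hb

theorem piece_eq (k : ℤ) : piece k = weightSum k := by
  unfold piece
  split_ifs with hk
  · rw [hk, weightSum_zero]
  · rfl

theorem lie_mem_piece {k l : ℤ} {x y : Monster} (hx : x ∈ piece k) (hy : y ∈ piece l) :
    ⁅x, y⁆ ∈ piece (k + l) := by
  rw [piece_eq] at *
  exact lie_mem_weightSum hx hy

/-- Sequences `(y_k)_{k ∈ ℤ}` in `L`, viewed as formal sums `∑ y_k`, that are finite in the negative
direction. -/
def FormalSum (L : Type) [LieRing L] [LieAlgebra ℂ L] : Submodule ℂ (ℤ → L) where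
  carrier := {y | ∃ N : ℤ, ∀ k < N, y k = 0}
  add_mem' := by
    rintro x y ⟨M, hM⟩ ⟨N, hN⟩
    exact ⟨min M N, fun k hk => by
      simp [hM k (lt_of_lt_of_le hk (min_le_left _ _)),
        hN k (lt_of_lt_of_le hk (min_le_right _ _))]⟩
  zero_mem' := ⟨0, fun _ _ => rfl⟩
  smul_mem' := by
    rintro r x ⟨M, hM⟩
    exact ⟨M, fun k hk => by simp [hM k hk]⟩

namespace FormalSum

set_option linter.unusedSectionVars false

variable {L : Type} [LieRing L] [LieAlgebra ℂ L]

/-- `x` has no components in degrees `< a`. -/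
def OrdGE (x : ℤ → L) (a : ℤ) : Prop := ∀ k < a, x k = 0

theorem OrdGE.mono {x : ℤ → L} {a b : ℤ} (h : OrdGE x a) (hab : b ≤ a) : OrdGE x b :=
  fun k hk => h k (lt_of_lt_of_le hk hab)

/-- The bracket of formal sums: `[x, y]_k = ∑_{i} [x_i, y_{k-i}]`. -/
def br (x y : ℤ → L) (k : ℤ) : L := ∑ᶠ i : ℤ, ⁅x i, y (k - i)⁆

theorem br_eq_sum {x y : ℤ → L} {a b : ℤ} (hx : OrdGE x a) (hy : OrdGE y b) (k : ℤ)
    {s : Finset ℤ} (hs : Finset.Icc a (k - b) ⊆ s) : br x y k = ∑ i ∈ s, ⁅x i, y (k - i)⁆ := by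
  refine finsum_eq_sum_of_support_subset _ fun i hi => hs ?_
  rw [Finset.mem_Icc]
  by_contra hcon
  apply hi
  by_cases h1 : a ≤ i
  · have : ¬ i ≤ k - b := fun h2 => hcon ⟨h1, h2⟩
    change ⁅x i, y (k - i)⁆ = 0
    rw [hy (k - i) (by lia), lie_zero]
  · change ⁅x i, y (k - i)⁆ = 0
    rw [hx i (by lia), zero_lie]

theorem br_ord {x y : ℤ → L} {a b : ℤ} (hx : OrdGE x a) (hy : OrdGE y b) :
    OrdGE (br x y) (a + b) := by
  intro k hk
  rw [br_eq_sum hx hy k (Finset.Subset.refl _), Finset.Icc_eq_empty (by lia), Finset.sum_empty]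

theorem jacobi {x y z : ℤ → L} {a : ℤ} (hx : OrdGE x a) (hy : OrdGE y a)
    (hz : OrdGE z a) :
    br x (br y z) = br (br x y) z + br y (br x z) := by
  funext k
  rw [Pi.add_apply]
  have hyz := br_ord hy hz
  have hxz := br_ord hx hz
  have hxy := br_ord hx hy
  set s := Finset.Icc a (k - 2 * a) with hs
  have hsub : ∀ i ∈ s, Finset.Icc a (k - i - a) ⊆ s := fun i hi => by
    rw [hs, Finset.mem_Icc] at hi
    exact Finset.Icc_subset_Icc le_rfl (by lia)
  have e1 : br x (br y z) k = ∑ i ∈ s, ∑ j ∈ s, ⁅x i, ⁅y j, z (k - i - j)⁆⁆ := by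
    rw [br_eq_sum hx hyz k (s := s) (Finset.Icc_subset_Icc le_rfl (by lia))]
    refine Finset.sum_congr rfl fun i hi => ?_
    rw [br_eq_sum hy hz (k - i) (hsub i hi), lie_sum]
  have e3 : br y (br x z) k = ∑ i ∈ s, ∑ j ∈ s, ⁅y j, ⁅x i, z (k - i - j)⁆⁆ := by
    rw [br_eq_sum hy hxz k (s := s) (Finset.Icc_subset_Icc le_rfl (by lia)), Finset.sum_comm]
    refine Finset.sum_congr rfl fun j hj => ?_
    rw [br_eq_sum hx hz (k - j) (hsub j hj), lie_sum]
    exact Finset.sum_congr rfl fun i _ => by rw [sub_right_comm]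
  have e2 : br (br x y) z k = ∑ i ∈ s, ∑ j ∈ s, ⁅⁅x i, y j⁆, z (k - i - j)⁆ := by
    rw [br_eq_sum hxy hz k (s := Finset.Icc (2 * a) (k - a))
      (Finset.Icc_subset_Icc (by lia) le_rfl)]
    have : ∀ l ∈ Finset.Icc (2 * a) (k - a), ⁅br x y l, z (k - l)⁆ =
        ∑ i ∈ s, ⁅⁅x i, y (l - i)⁆, z (k - l)⁆ := by
      intro l hl
      rw [Finset.mem_Icc] at hl
      rw [br_eq_sum hx hy l (s := s) (Finset.Icc_subset_Icc le_rfl (by lia)), sum_lie]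
    rw [Finset.sum_congr rfl this, Finset.sum_comm]
    refine Finset.sum_congr rfl fun i hi => ?_
    rw [hs, Finset.mem_Icc] at hi
    rw [← Finset.sum_subset (hsub i (by rw [hs, Finset.mem_Icc]; exact hi))]
    · symm
      have himg : Finset.image (fun j => i + j) (Finset.Icc a (k - i - a)) ⊆
          Finset.Icc (2 * a) (k - a) := by
        intro l hl
        simp only [Finset.mem_image, Finset.mem_Icc] at hl ⊢
        lia
      rw [← Finset.sum_subset himg]
      · rw [Finset.sum_image (fun p _ q _ hpq => by simpa using hpq)]
        refine Finset.sum_congr rfl fun j _ => ?_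
        rw [add_sub_cancel_left, sub_sub]
      · intro l hl hl'
        simp only [Finset.mem_image, Finset.mem_Icc, not_exists, not_and] at hl hl'
        rw [hy (l - i) ?_, lie_zero, zero_lie]
        by_contra hcon
        exact hl' (l - i) ⟨by lia, by lia⟩ (by lia)
    · intro j hj hj'
      rw [hs, Finset.mem_Icc] at hj
      rw [Finset.mem_Icc] at hj'
      rw [hz (k - i - j) (by lia), lie_zero]
  rw [e1, e2, e3, ← Finset.sum_add_distrib]
  refine Finset.sum_congr rfl fun i _ => ?_
  rw [← Finset.sum_add_distrib]
  exact Finset.sum_congr rfl fun j _ => leibniz_lie _ _ _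

theorem common (x y : FormalSum L) : ∃ a, OrdGE x.1 a ∧ OrdGE y.1 a := by
  obtain ⟨⟨x, M, hM⟩, ⟨y, N, hN⟩⟩ := x, y
  exact ⟨min M N, OrdGE.mono (a := M) hM (min_le_left _ _),
    OrdGE.mono (a := N) hN (min_le_right _ _)⟩

instance : Bracket (FormalSum L) (FormalSum L) where
  bracket x y := ⟨br x.1 y.1, by
    obtain ⟨a, hx, hy⟩ := common x y
    exact ⟨a + a, br_ord hx hy⟩⟩

theorem lie_apply (x y : FormalSum L) (k : ℤ) : (⁅x, y⁆ : FormalSum L).1 k = br x.1 y.1 k := rfl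

instance : LieRing (FormalSum L) where
  add_lie x y z := by
    obtain ⟨a, hx, hy⟩ := common x y
    obtain ⟨b, hz⟩ := z.2
    apply Subtype.ext
    funext k
    change br (x.1 + y.1) z.1 k = br x.1 z.1 k + br y.1 z.1 k
    have hxy : OrdGE (x.1 + y.1) a := fun k hk => by simp [hx k hk, hy k hk]
    rw [br_eq_sum hxy hz k (Finset.Subset.refl _), br_eq_sum hx hz k (Finset.Subset.refl _),
      br_eq_sum hy hz k (Finset.Subset.refl _), ← Finset.sum_add_distrib]
    exact Finset.sum_congr rfl fun i _ => add_lie _ _ _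
  lie_add x y z := by
    obtain ⟨a, hy, hz⟩ := common y z
    obtain ⟨b, hx⟩ := x.2
    apply Subtype.ext
    funext k
    change br x.1 (y.1 + z.1) k = br x.1 y.1 k + br x.1 z.1 k
    have hyz : OrdGE (y.1 + z.1) a := fun k hk => by simp [hy k hk, hz k hk]
    rw [br_eq_sum hx hyz k (Finset.Subset.refl _), br_eq_sum hx hy k (Finset.Subset.refl _),
      br_eq_sum hx hz k (Finset.Subset.refl _), ← Finset.sum_add_distrib]
    exact Finset.sum_congr rfl fun i _ => lie_add _ _ _
  lie_self x := by
    obtain ⟨a, hx⟩ := x.2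
    apply Subtype.ext
    funext k
    change br x.1 x.1 k = 0
    have hx' : OrdGE x.1 a := hx
    rw [br_eq_sum hx' hx' k (Finset.Subset.refl _)]
    refine Finset.sum_involution (fun i _ => k - i) ?_ ?_ ?_ ?_
    · intro i _
      rw [sub_sub_cancel, ← lie_skew, neg_add_cancel]
    · intro i _ hi hki
      apply hi
      rw [hki, lie_self]
    · intro i hi
      rw [Finset.mem_Icc] at hi ⊢
      lia
    · intro i _
      exact sub_sub_cancel _ _
  leibniz_lie x y z := by
    obtain ⟨a, hx, hy⟩ := common x y
    obtain ⟨b, _, hz⟩ := common x z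
    apply Subtype.ext
    exact jacobi (a := min a b)
      (hx.mono (min_le_left _ _))
      (hy.mono (min_le_left _ _))
      (hz.mono (min_le_right _ _))

instance : LieAlgebra ℂ (FormalSum L) where
  lie_smul r x y := by
    obtain ⟨a, hx, hy⟩ := common x y
    apply Subtype.ext
    funext k
    change br x.1 (r • y.1) k = r • br x.1 y.1 k
    have hy' : OrdGE (r • y.1) a := fun k hk => by simp [hy k hk]
    rw [br_eq_sum hx hy' k (Finset.Subset.refl _), br_eq_sum hx hy k (Finset.Subset.refl _),
      Finset.smul_sum]
    exact Finset.sum_congr rfl fun i _ => lie_smul _ _ _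

end FormalSum

theorem mem_of_br {L : Type} [LieRing L] [LieAlgebra ℂ L] {P : ℤ → Submodule ℂ L}
    (hP : ∀ {k l : ℤ} {x y : L}, x ∈ P k → y ∈ P l → ⁅x, y⁆ ∈ P (k + l)) {x y : FormalSum L}
    (hx : ∀ k, x.1 k ∈ P k) (hy : ∀ k, y.1 k ∈ P k) (k : ℤ) :
    (⁅x, y⁆ : FormalSum L).1 k ∈ P k := by
  obtain ⟨a, ha, hb⟩ := FormalSum.common x y
  rw [FormalSum.lie_apply, FormalSum.br_eq_sum ha hb k (Finset.Subset.refl _)]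
  refine sum_mem fun i _ => ?_
  have := hP (hx i) (hy (k - i))
  rwa [add_sub_cancel] at this

/-- The completion `𝔪̂ = 𝔫⁻ ⊕ 𝔥 ⊕ 𝔫̂⁺ ⊆ ∏_{k ∈ ℤ} 𝔪_k`: formal sums `∑ y_k` with `y_k ∈ 𝔪_k` for all
`k ∈ ℤ` and `y_k = 0` for all sufficiently small `k`, with bracket
`[x, y]_k = ∑_{i + j = k} [x_i, y_j]`. -/
def completionSubalgebra : LieSubalgebra ℂ (FormalSum Monster) where
  carrier := {y | ∀ k, y.1 k ∈ piece k}
  add_mem' hx hy k := add_mem (hx k) (hy k)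
  zero_mem' k := (piece k).zero_mem
  smul_mem' r _ hx k := (piece k).smul_mem r (hx k)
  lie_mem' hx hy k := mem_of_br lie_mem_piece hx hy k

/-- The Lie algebra `𝔪̂`. -/
def Completion : Type := completionSubalgebra

instance : LieRing Completion := inferInstanceAs (LieRing completionSubalgebra)
instance : LieAlgebra ℂ Completion := inferInstanceAs (LieAlgebra ℂ completionSubalgebra)

namespace Completion

/-- The component `(y)_k ∈ 𝔪_k` of `y ∈ 𝔪̂`, as a linear map to `𝔪`. -/
def comp (k : ℤ) : Completion →ₗ[ℂ] Monster where
  toFun y := y.1.1 k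
  map_add' _ _ := rfl
  map_smul' _ _ := rfl

@[ext]
theorem ext {x y : Completion} (h : ∀ k, comp k x = comp k y) : x = y :=
  Subtype.ext (Subtype.ext (funext h))

theorem comp_lie (x y : Completion) (k : ℤ) :
    comp k ⁅x, y⁆ = ∑ᶠ i : ℤ, ⁅comp i x, comp (k - i) y⁆ := rfl

/-- `𝔪_k`, as the subspace of `𝔪̂` of the elements concentrated in degree `k`. -/
def homogeneous (k : ℤ) : Submodule ℂ Completion where
  carrier := {y | ∀ l, l ≠ k → comp l y = 0}
  add_mem' hx hy l hl := by rw [map_add, hx l hl, hy l hl, add_zero]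
  zero_mem' l _ := map_zero _
  smul_mem' r x hx l hl := by rw [map_smul, hx l hl, smul_zero]

/-- `𝔫̂⁺_n = ∏_{j ≥ n} 𝔪_j`, as the subspace of `𝔪̂` of the elements without components in degrees
less than `n`; here `n` is any integer. -/
def nHat (n : ℤ) : Submodule ℂ Completion where
  carrier := {y | ∀ k < n, comp k y = 0}
  add_mem' hx hy l hl := by rw [map_add, hx l hl, hy l hl, add_zero]
  zero_mem' l _ := map_zero _
  smul_mem' r x hx l hl := by rw [map_smul, hx l hl, smul_zero]

theorem nHat_mono {m n : ℤ} (h : m ≤ n) : nHat n ≤ nHat m :=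
  fun _ hy k hk => hy k (lt_of_lt_of_le hk h)

theorem lie_mem_nHat {m n : ℤ} {x y : Completion} (hx : x ∈ nHat m) (hy : y ∈ nHat n) :
    ⁅x, y⁆ ∈ nHat (m + n) := FormalSum.br_ord (x := x.1.1) (y := y.1.1) hx hy

theorem exists_mem_nHat (y : Completion) : ∃ N, y ∈ nHat N := y.1.2

theorem eq_zero_of_forall {y : Completion} (N : ℤ) (h : ∀ M : ℕ, y ∈ nHat (N + M)) : y = 0 := by
  ext k
  rw [map_zero]
  exact h (k - N + 1).toNat k (by have := Int.self_le_toNat (k - N + 1); lia)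

/-- The subalgebra `𝔫̂⁺_im = ∏_{k ≥ 1} 𝔪_k` of `𝔪̂`. -/
def nIm : LieSubalgebra ℂ Completion :=
  { nHat 1 with
    lie_mem' := fun {x y} hx hy => nHat_mono (by norm_num) (lie_mem_nHat (m := 1) (n := 1) hx hy) }

/-- A series `∑ ϑ_i` of operators on `𝔪̂` is pro-summable if for all `y` and `k` only finitely many
`i` satisfy `(ϑ_i y)_k ≠ 0`. -/
def ProSummable {ι : Type} (ϑ : ι → Completion → Completion) : Prop :=
  ∀ (y : Completion) (k : ℤ), {i | comp k (ϑ i y) ≠ 0}.Finite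

/-- The `i`-th term `ad(x)^i / i!` of the exponential series. -/
def expTerm (x : Completion) (i : ℕ) : Module.End ℂ Completion :=
  ((Nat.factorial i : ℂ)⁻¹) • LieAlgebra.ad ℂ Completion x ^ i

theorem ad_pow_mem_nHat {x : Completion} (hx : x ∈ nHat 1) {N : ℤ} {y : Completion}
    (hy : y ∈ nHat N) (i : ℕ) : (LieAlgebra.ad ℂ Completion x ^ i) y ∈ nHat (N + i) := by
  induction i with
  | zero => simpa using hy
  | succ i ih =>
    rw [pow_succ', Module.End.mul_apply, LieAlgebra.ad_apply]
    have := lie_mem_nHat hx ih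
    convert this using 2
    push_cast; ring

theorem expTerm_mem_nHat {x : Completion} (hx : x ∈ nHat 1) {N : ℤ} {y : Completion}
    (hy : y ∈ nHat N) (i : ℕ) : expTerm x i y ∈ nHat (N + i) :=
  Submodule.smul_mem _ _ (ad_pow_mem_nHat hx hy i)

theorem expTerm_proSummable (x : nIm) : ProSummable fun i => expTerm x i := by
  intro y k
  obtain ⟨N, hN⟩ := exists_mem_nHat y
  refine (Set.finite_le_nat (k - N).toNat).subset fun i hi => ?_
  by_contra hcon
  simp only [Set.mem_ofPred_eq, not_le] at hcon
  refine hi (expTerm_mem_nHat x.2 hN i k ?_)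
  have := Int.self_le_toNat (k - N)
  lia

theorem expSum_eq (x : nIm) {N : ℤ} {y : Completion} (hy : y ∈ nHat N) (k : ℤ) (M : ℕ)
    (hM : k < N + M) :
    ∑ᶠ i : ℕ, comp k (expTerm x i y) = ∑ i ∈ Finset.range M, comp k (expTerm x i y) := by
  refine finsum_eq_sum_of_support_subset _ fun i hi => ?_
  by_contra hcon
  simp only [Finset.coe_range, Set.mem_Iio, not_lt] at hcon
  exact hi (expTerm_mem_nHat x.2 hy i k (by lia))

/-- The operator `exp(ad x) = ∑ ad(x)^i / i!` on `𝔪̂`, for `x ∈ 𝔫̂⁺_im`, defined as the sum of a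
pro-summable series: `(exp(ad x) y)_k` is the finite sum of the nonzero `(ad(x)^i y / i!)_k`. -/
def expFun (x : nIm) (y : Completion) : Completion :=
  ⟨⟨fun k => ∑ᶠ i : ℕ, comp k (expTerm x i y), by
    obtain ⟨N, hN⟩ := exists_mem_nHat y
    refine ⟨N, fun k hk => ?_⟩
    change ∑ᶠ i : ℕ, comp k (expTerm x i y) = 0
    rw [expSum_eq x hN k 0 (by simpa using hk), Finset.sum_range_zero]⟩,
    fun k => by
      obtain ⟨N, hN⟩ := exists_mem_nHat y
      change ∑ᶠ i : ℕ, comp k (expTerm x i y) ∈ piece k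
      rw [expSum_eq x hN k ((k - N).toNat + 1)
        (by have := Int.self_le_toNat (k - N); push_cast; lia)]
      exact sum_mem fun i _ => (expTerm x i y).2 k⟩

theorem comp_expFun (x : nIm) (y : Completion) (k : ℤ) :
    comp k (expFun x y) = ∑ᶠ i : ℕ, comp k (expTerm x i y) := rfl

/-- The partial sums of the exponential series. -/
def partialExp (x : Completion) (M : ℕ) : Module.End ℂ Completion :=
  ∑ i ∈ Finset.range M, expTerm x i

theorem expFun_approx (x : nIm) {N : ℤ} {y : Completion} (hy : y ∈ nHat N) (M : ℕ) :
    expFun x y - partialExp x M y ∈ nHat (N + M) := by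
  intro k hk
  rw [map_sub, comp_expFun, expSum_eq x hy k M hk, partialExp, LinearMap.sum_apply, map_sum,
    sub_self]

theorem partialExp_mem (x : nIm) {N : ℤ} {y : Completion} (hy : y ∈ nHat N) (M : ℕ) :
    partialExp x M y ∈ nHat N := by
  rw [partialExp, LinearMap.sum_apply]
  exact sum_mem fun i _ => nHat_mono (by lia) (expTerm_mem_nHat x.2 hy i)

theorem expFun_mem (x : nIm) {N : ℤ} {y : Completion} (hy : y ∈ nHat N) :
    expFun x y ∈ nHat N := by
  have := expFun_approx x hy 0
  simpa [partialExp] using this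

/-- `exp(ad x)` as a linear map. -/
def expLin (x : nIm) : Completion →ₗ[ℂ] Completion where
  toFun := expFun x
  map_add' y z := by
    obtain ⟨N, hN⟩ := exists_mem_nHat y
    obtain ⟨N', hN'⟩ := exists_mem_nHat z
    have hy : y ∈ nHat (min N N') := nHat_mono (min_le_left _ _) hN
    have hz : z ∈ nHat (min N N') := nHat_mono (min_le_right _ _) hN'
    rw [← sub_eq_zero]
    refine eq_zero_of_forall (min N N') fun M => ?_
    have h1 := expFun_approx x (add_mem hy hz) M
    have h2 := expFun_approx x hy M
    have h3 := expFun_approx x hz M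
    have := sub_mem h1 (add_mem h2 h3)
    rw [map_add] at this
    convert this using 1
    abel
  map_smul' r y := by
    obtain ⟨N, hy⟩ := exists_mem_nHat y
    rw [← sub_eq_zero]
    refine eq_zero_of_forall N fun M => ?_
    have h1 := expFun_approx x (Submodule.smul_mem _ r hy) M
    have h2 := expFun_approx x hy M
    have := sub_mem h1 (Submodule.smul_mem _ r h2)
    rw [map_smul, smul_sub] at this
    convert this using 1
    simp

theorem coeff_factorial {n : ℕ} {p : ℕ × ℕ} (hp : p ∈ Finset.HasAntidiagonal.antidiagonal n) :
    (n.factorial : ℂ)⁻¹ * (n.choose p.1 : ℂ) = (p.1.factorial : ℂ)⁻¹ * (p.2.factorial : ℂ)⁻¹ := by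
  rw [Finset.HasAntidiagonal.mem_antidiagonal] at hp
  subst hp
  have h1 := Nat.add_choose_mul_factorial_mul_factorial p.1 p.2
  rw [← Nat.choose_symm_add] at h1
  have h2 : ((p.1 + p.2).choose p.1 : ℂ) * (p.1.factorial : ℂ) * (p.2.factorial : ℂ) =
      ((p.1 + p.2).factorial : ℂ) := by exact_mod_cast h1
  have h3 : ((p.1 + p.2).factorial : ℂ) ≠ 0 := by exact_mod_cast Nat.factorial_ne_zero _
  have h4 : (p.1.factorial : ℂ) ≠ 0 := by exact_mod_cast Nat.factorial_ne_zero _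
  have h5 : (p.2.factorial : ℂ) ≠ 0 := by exact_mod_cast Nat.factorial_ne_zero _
  field_simp
  linear_combination h2

theorem square_sub_triangle {K : ℤ} {g : ℕ × ℕ → Completion}
    (hg : ∀ p, g p ∈ nHat (K + (p.1 + p.2 : ℕ))) (M : ℕ) :
    ∑ p ∈ Finset.range M ×ˢ Finset.range M, g p -
      ∑ n ∈ Finset.range M, ∑ p ∈ Finset.HasAntidiagonal.antidiagonal n, g p ∈ nHat (K + M) := by
  classical
  have h1 : ∑ n ∈ Finset.range M, ∑ p ∈ Finset.HasAntidiagonal.antidiagonal n, g p =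
      ∑ p ∈ (Finset.range M ×ˢ Finset.range M).filter (fun p : ℕ × ℕ => p.1 + p.2 < M), g p := by
    rw [← Finset.sum_fiberwise_of_maps_to (t := Finset.range M) (g := fun p : ℕ × ℕ => p.1 + p.2)
      (fun p hp => by simpa using (Finset.mem_filter.1 hp).2)]
    refine Finset.sum_congr rfl fun n hn => Finset.sum_congr ?_ fun _ _ => rfl
    ext p
    simp only [Finset.HasAntidiagonal.mem_antidiagonal, Finset.mem_filter, Finset.mem_product, Finset.mem_range]
      at hn ⊢
    lia
  rw [h1, ← Finset.sum_filter_add_sum_filter_not (Finset.range M ×ˢ Finset.range M)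
    (fun p : ℕ × ℕ => p.1 + p.2 < M), add_sub_cancel_left]
  refine sum_mem fun p hp => nHat_mono ?_ (hg p)
  have := (Finset.mem_filter.1 hp).2
  push_cast
  lia

theorem expTerm_lie (x y z : Completion) (n : ℕ) :
    expTerm x n ⁅y, z⁆ = ∑ p ∈ Finset.HasAntidiagonal.antidiagonal n, ⁅expTerm x p.1 y, expTerm x p.2 z⁆ := by
  have h1 := LieDerivation.iterate_apply_lie (LieDerivation.ad ℂ Completion x) n y z
  have h2 : ∀ (m : ℕ) (w : Completion),
      (LieAlgebra.ad ℂ Completion x ^ m) w = (LieDerivation.ad ℂ Completion x)^[m] w := by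
    intro m w
    have hfun : ⇑(LieAlgebra.ad ℂ Completion x) = ⇑(LieDerivation.ad ℂ Completion x) := by
      funext v
      simp
    rw [Module.End.pow_apply, hfun]
  simp only [expTerm, LinearMap.smul_apply, h2, h1, Finset.smul_sum]
  refine Finset.sum_congr rfl fun p hp => ?_
  rw [smul_lie, lie_smul, smul_smul, ← coeff_factorial hp, mul_smul, Nat.cast_smul_eq_nsmul]

theorem expTerm_neg_sum (x y : Completion) (n : ℕ) :
    ∑ p ∈ Finset.HasAntidiagonal.antidiagonal n, expTerm (-x) p.1 (expTerm x p.2 y) = if n = 0 then y else 0 := by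
  have hc : Commute (LieAlgebra.ad ℂ Completion (-x)) (LieAlgebra.ad ℂ Completion x) := by
    rw [map_neg]
    exact (Commute.refl _).neg_left
  have h1 := hc.add_pow' n
  have h2 : ∑ p ∈ Finset.HasAntidiagonal.antidiagonal n, expTerm (-x) p.1 (expTerm x p.2 y) =
      (n.factorial : ℂ)⁻¹ • ((LieAlgebra.ad ℂ Completion (-x) +
        LieAlgebra.ad ℂ Completion x) ^ n) y := by
    rw [h1, LinearMap.sum_apply, Finset.smul_sum]
    refine Finset.sum_congr rfl fun p hp => ?_
    simp only [expTerm, LinearMap.smul_apply, map_smul, Module.End.mul_apply]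
    rw [smul_smul, mul_comm, ← coeff_factorial hp, mul_smul, Nat.cast_smul_eq_nsmul]
  rw [h2, map_neg, neg_add_cancel]
  split_ifs with hn
  · subst hn; simp
  · rw [zero_pow hn]; simp

theorem partialExp_mul_neg (x : nIm) {N : ℤ} {y : Completion} (hy : y ∈ nHat N) (M : ℕ) :
    partialExp (-x : nIm) M (partialExp x M y) - y ∈ nHat (N + M) := by
  rcases Nat.eq_zero_or_pos M with rfl | hM
  · simpa [partialExp] using hy
  have := square_sub_triangle (K := N)
    (g := fun p => expTerm (-x : nIm) p.1 (expTerm x p.2 y)) (fun p => by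
      have := expTerm_mem_nHat (-x : nIm).2 (expTerm_mem_nHat x.2 hy p.2) p.1
      convert this using 2
      push_cast; ring) M
  convert this using 2
  · rw [Finset.sum_product]
    simp only [partialExp, LinearMap.sum_apply, map_sum]
    rw [Finset.sum_comm]
  · have h1 : ∀ n, ∑ p ∈ Finset.HasAntidiagonal.antidiagonal n, expTerm (-x : nIm) p.1 (expTerm x p.2 y) =
        if n = 0 then y else 0 := expTerm_neg_sum x y
    simp only [h1]
    rw [Finset.sum_ite_eq' (Finset.range M) 0 (fun _ => y), if_pos (by simpa using hM)]

theorem expFun_neg (x : nIm) (y : Completion) : expFun (-x) (expFun x y) = y := by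
  obtain ⟨N, hy⟩ := exists_mem_nHat y
  rw [← sub_eq_zero]
  refine eq_zero_of_forall N fun M => ?_
  have h1 := expFun_approx (-x) (expFun_mem x hy) M
  have h2 := partialExp_mem (-x) (expFun_approx x hy M) M
  have h3 := partialExp_mul_neg x hy M
  have := add_mem (add_mem h1 h2) h3
  rw [map_sub] at this
  convert this using 1
  abel

theorem partialExp_lie (x : nIm) {N : ℤ} {y z : Completion} (hy : y ∈ nHat N) (hz : z ∈ nHat N)
    (M : ℕ) :
    partialExp x M ⁅y, z⁆ - ⁅partialExp x M y, partialExp x M z⁆ ∈ nHat (N + N + M) := by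
  have := square_sub_triangle (K := N + N)
    (g := fun p => ⁅expTerm x p.1 y, expTerm x p.2 z⁆) (fun p => by
      have := lie_mem_nHat (expTerm_mem_nHat x.2 hy p.1) (expTerm_mem_nHat x.2 hz p.2)
      convert this using 2
      push_cast; ring) M
  rw [← neg_mem_iff, neg_sub]
  convert this using 2
  · simp only [Finset.sum_product, partialExp, LinearMap.sum_apply, sum_lie, lie_sum]
    rw [Finset.sum_comm]
  · simp only [partialExp, LinearMap.sum_apply, expTerm_lie]

theorem expFun_lie (x : nIm) (y z : Completion) :
    expFun x ⁅y, z⁆ = ⁅expFun x y, expFun x z⁆ := by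
  obtain ⟨N, hN⟩ := exists_mem_nHat y
  obtain ⟨N', hN'⟩ := exists_mem_nHat z
  have hy : y ∈ nHat (min N N') := nHat_mono (min_le_left _ _) hN
  have hz : z ∈ nHat (min N N') := nHat_mono (min_le_right _ _) hN'
  set K := min N N'
  rw [← sub_eq_zero]
  refine eq_zero_of_forall (K + K) fun M => ?_
  have h1 := expFun_approx x (lie_mem_nHat hy hz) M
  have h2 := partialExp_lie x hy hz M
  have h3 := lie_mem_nHat (expFun_approx x hy M) (expFun_mem x hz)
  have h4 := lie_mem_nHat (partialExp_mem x hy M) (expFun_approx x hz M)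
  rw [show K + M + K = K + K + M by ring] at h3
  rw [← add_assoc] at h4
  have := sub_mem (sub_mem (add_mem h1 h2) h3) h4
  rw [sub_lie, lie_sub] at this
  convert this using 1
  abel

/-- The automorphism `exp(ad x)` of the Lie algebra `𝔪̂`, for `x ∈ 𝔫̂⁺_im`. -/
def expAd (x : nIm) : Completion ≃ₗ⁅ℂ⁆ Completion where
  toFun := expFun x
  map_add' := (expLin x).map_add'
  map_smul' := (expLin x).map_smul'
  map_lie' {y z} := expFun_lie x y z
  invFun := expFun (-x)
  left_inv := expFun_neg x
  right_inv y := by simpa using expFun_neg (-x) y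

/-- The group `Aut(𝔪̂)` of Lie algebra automorphisms, with `(φ ψ)(y) = φ(ψ(y))`. -/
instance : Group (Completion ≃ₗ⁅ℂ⁆ Completion) where
  mul φ ψ := ψ.trans φ
  one := 1
  inv φ := φ.symm
  mul_assoc _ _ _ := rfl
  one_mul _ := rfl
  mul_one _ := rfl
  inv_mul_cancel φ := LieEquiv.self_trans_symm φ

/-- `Û⁺_n`: the set of automorphisms `φ` of `𝔪̂` with `φ(y) ∈ y + 𝔫̂⁺_{k+n}` for all `k ∈ ℤ` and
`y ∈ 𝔪_k`. -/
def uHat (n : ℕ) : Set (Completion ≃ₗ⁅ℂ⁆ Completion) :=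
  {φ | ∀ (k : ℤ), ∀ y ∈ homogeneous k, φ y - y ∈ nHat (k + n)}

end Completion
end
end MonsterLie

open MonsterLie (Completion)
open MonsterLie.Completion (uHat expAd nIm nHat homogeneous)

namespace MonsterLie

namespace Completion

/-! The proof is governed by the element `d = h₁ + h₂`, placed in degree `0` (`gradingElement`):
bracketing with `d` multiplies the degree-`k` component by `k`. Hence `ad d` recovers the grading,
and it is invertible on `nHat n` for `n ≥ 1`. Two consequences give assertion 1.

Existence (`exists_expFun_gradingElement`): every `d + u` with `u ∈ nHat n` equals `exp(ad x) d` for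
some `x ∈ nHat n`. To first order, replacing `x` by `x + w` changes `exp(ad x) d` by `[w, d]`, so
the lowest term of the error can be removed by inverting `ad d`. The corrections lie ever deeper in
the filtration and converge by completeness.

Rigidity (`eq_one_of_fixes_gradingElement`): an automorphism in `uHat 1` that fixes `d` commutes
with `ad d`, so it preserves degrees. As it is also the identity modulo higher degrees, it is
trivial on homogeneous elements, and then everywhere.

For `φ ∈ uHat n`, existence gives `x` with `exp(ad x) d = φ d`, and rigidity applied to `exp(ad x)⁻¹
φ` gives `φ = exp(ad x)`.

Assertions 2 to 4 are computations modulo deeper filtration steps. They rest on the estimate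
`expFun_sub_expFun`, that `exp(ad x) y - exp(ad x') y` is `[x - x', y]` up to higher degree. For the
commutator one adds the conjugation rule `map_expFun`. Of the homogeneity of `x` and `y` only
membership in `nHat n` and `nHat m` is needed. -/

/-! ### The grading element and its eigenspaces. -/

theorem coe_add (x y : nIm) : ((x + y : nIm) : Completion) = x + y := rfl

theorem comp_mem_piece (y : Completion) (k : ℤ) : comp k y ∈ piece k := y.2 k

/-- The formal sum with prescribed components, vanishing in degrees less than `N`. -/
noncomputable def ofComponents (y : ℤ → Monster) (N : ℤ) (hN : ∀ k < N, y k = 0) (hy : ∀ k, y k ∈ piece k) :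
    Completion := ⟨⟨y, N, hN⟩, hy⟩

theorem comp_ofComponents (y : ℤ → Monster) (N : ℤ) (hN : ∀ k < N, y k = 0)
    (hy : ∀ k, y k ∈ piece k) (k : ℤ) : comp k (ofComponents y N hN hy) = y k := rfl

/-- The grading element `h₁ + h₂`, placed in degree `0`. -/
noncomputable def gradingElement : Completion :=
  ofComponents (Pi.single 0 (h₁ + h₂)) 0 (fun k hk => by rw [Pi.single_eq_of_ne hk.ne])
    fun k => by
      rcases eq_or_ne k 0 with rfl | hk
      · simpa [piece] using add_mem h₁_mem h₂_mem
      · rw [Pi.single_eq_of_ne hk]; exact zero_mem _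

theorem gradingElement_mem_homogeneous : gradingElement ∈ homogeneous 0 := fun k hk => by
  rw [gradingElement, comp_ofComponents, Pi.single_eq_of_ne hk]

theorem homogeneous_le_nHat (k : ℤ) : homogeneous k ≤ nHat k := fun _ hy l hl => hy l hl.ne

theorem gradingElement_mem_nHat : gradingElement ∈ nHat 0 :=
  homogeneous_le_nHat 0 gradingElement_mem_homogeneous

/-- Only the degree-`0` component of the grading element is nonzero, so the bracket reduces to the
action of `h₁ + h₂` on one piece. Degree `0` is no exception, because `piece_eq` identifies `gl2`
with the sum of root spaces of total degree `0`. -/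
theorem comp_gradingElement_lie (y : Completion) (k : ℤ) :
    comp k ⁅gradingElement, y⁆ = (k : ℂ) • comp k y := by
  rw [comp_lie, finsum_eq_single _ 0 fun i hi => by
    rw [gradingElement_mem_homogeneous i hi, zero_lie]]
  have hy := comp_mem_piece y k
  rw [piece_eq] at hy
  have := weightSum_le k hy
  rw [Module.End.mem_eigenspace_iff, LieAlgebra.ad_apply] at this
  rw [sub_zero, gradingElement, comp_ofComponents, Pi.single_eq_same, this]

/-- Describing homogeneity by an eigenvalue equation makes it visible to any automorphism that fixes
the grading element. -/
theorem mem_homogeneous_of_lie {y : Completion} {k : ℤ}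
    (hy : ⁅gradingElement, y⁆ = (k : ℂ) • y) : y ∈ homogeneous k := by
  intro l hl
  have h1 := congrArg (comp l) hy
  rw [comp_gradingElement_lie, map_smul, ← sub_eq_zero, ← sub_smul, smul_eq_zero] at h1
  exact h1.resolve_left (sub_ne_zero.2 (by exact_mod_cast hl))

theorem gradingElement_lie {y : Completion} {k : ℤ} (hy : y ∈ homogeneous k) :
    ⁅gradingElement, y⁆ = (k : ℂ) • y := by
  ext l
  rw [comp_gradingElement_lie, map_smul]
  rcases eq_or_ne l k with rfl | hl
  · rfl
  · rw [hy l hl, smul_zero, smul_zero]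

/-- On `𝔫̂⁺_M` the operator `ad(h₁ + h₂) - k` is onto if `k < M`. -/
theorem exists_lie_sub_eq {M k : ℤ} (hk : k < M) {z : Completion} (hz : z ∈ nHat M) :
    ∃ w ∈ nHat M, ⁅gradingElement, w⁆ - (k : ℂ) • w = z := by
  -- Divide by the eigenvalue `l - k` in each degree. At `l = k` the inverse is the default value
  -- `0`, which is harmless: `k < M` forces that component of `z` to vanish.
  refine ⟨ofComponents (fun l => ((l : ℂ) - k)⁻¹ • comp l z) M
    (fun l hl => by rw [hz l hl, smul_zero])
    (fun l => Submodule.smul_mem _ _ (comp_mem_piece z l)), fun l hl => ?_, ?_⟩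
  · rw [comp_ofComponents, hz l hl, smul_zero]
  · ext l
    rw [map_sub, comp_gradingElement_lie, map_smul, ← sub_smul, comp_ofComponents, smul_smul]
    rcases eq_or_ne l k with rfl | hl
    · rw [hz l hk, smul_zero]
    · rw [mul_inv_cancel₀ (sub_ne_zero.2 (by exact_mod_cast hl)), one_smul]

/-! ### Completeness, and first-order estimates for the exponential. -/

/-- Completeness of the filtration by the `𝔫̂⁺_n`. -/
theorem exists_limit {N : ℤ} {s : ℕ → Completion} (h0 : s 0 ∈ nHat N)
    (hs : ∀ m : ℕ, s (m + 1) - s m ∈ nHat (N + m)) :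
    ∃ x ∈ nHat N, ∀ m : ℕ, x - s m ∈ nHat (N + m) := by
  have hle : ∀ a b : ℕ, s (a + b) - s a ∈ nHat (N + a) := by
    intro a b
    induction b with
    | zero => simp
    | succ b ih =>
      have h1 := nHat_mono (m := N + a) (by push_cast; lia) (hs (a + b))
      have := add_mem h1 ih
      rwa [sub_add_sub_cancel] at this
  -- The component in degree `k` is stable from index `k - N + 1` on, since the later increments
  -- start in degrees above `k`. For `k < N` the `toNat` truncates this index to `0`, where `s 0 ∈
  -- nHat N` makes the component vanish.
  have key : ∀ (m : ℕ) (k : ℤ), k < N + m → comp k (s m) = comp k (s (k - N + 1).toNat) := by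
    intro m k hk
    obtain ⟨b, hb⟩ := Nat.exists_eq_add_of_le (show (k - N + 1).toNat ≤ m by lia)
    have := hle (k - N + 1).toNat b k (by lia)
    rwa [← hb, map_sub, sub_eq_zero] at this
  have hlow : ∀ k < N, comp k (s (k - N + 1).toNat) = 0 := fun k hk => by
    rw [← key 0 k (by simpa using hk)]; exact h0 k hk
  refine ⟨ofComponents (fun k => comp k (s (k - N + 1).toNat)) N hlow
    (fun k => comp_mem_piece _ k), hlow, fun m k hk => ?_⟩
  rw [map_sub, comp_ofComponents, key m k hk, sub_self]

/-- Telescoping: the new difference is `[x, old difference] + [x - x', ad(x')^(i+1) y]`. One factor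
`x - x'` raises the degree by `p`, and each of the other `i` factors raises it by at least `1`. -/
theorem ad_pow_sub_mem {x x' : Completion} (hx : x ∈ nHat 1) (hx' : x' ∈ nHat 1) {p N : ℤ}
    (hp : x - x' ∈ nHat p) {y : Completion} (hy : y ∈ nHat N) (i : ℕ) :
    (LieAlgebra.ad ℂ Completion x ^ (i + 1)) y - (LieAlgebra.ad ℂ Completion x' ^ (i + 1)) y ∈
      nHat (N + p + i) := by
  induction i with
  | zero => simpa [← sub_lie, add_comm] using lie_mem_nHat hp hy
  | succ i ih =>
    rw [pow_succ' _ (i + 1), pow_succ' _ (i + 1), Module.End.mul_apply, Module.End.mul_apply,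
      LieAlgebra.ad_apply, LieAlgebra.ad_apply]
    have h1 := lie_mem_nHat hx ih
    have h2 := lie_mem_nHat hp (ad_pow_mem_nHat hx' hy (i + 1))
    rw [show (1 : ℤ) + (N + p + i) = N + p + (i + 1 : ℕ) by push_cast; ring] at h1
    rw [show p + (N + (i + 1 : ℕ)) = N + p + (i + 1 : ℕ) by ring] at h2
    have := add_mem h1 h2
    rw [lie_sub, sub_lie] at this
    simpa using this

/-- First-order dependence of `exp(ad x)` on `x`. -/
theorem expFun_sub_expFun (x x' : nIm) {p : ℕ} (hp : 1 ≤ p)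
    (hxp : (x : Completion) - x' ∈ nHat p) {N : ℤ} {y : Completion} (hy : y ∈ nHat N) :
    expFun x y - expFun x' y - ⁅(x : Completion) - x', y⁆ ∈ nHat (N + p + 1) := by
  -- Truncating after `p + 1` terms costs exactly the permitted error. Among the remaining terms,
  -- those of order `0` cancel, those of order `1` give the bracket, and the order `i + 2` terms
  -- differ in degree at least `N + p + i + 1`.
  have h1 := expFun_approx x hy (p + 1)
  have h2 := expFun_approx x' hy (p + 1)
  have h3 : partialExp x (p + 1) y - partialExp x' (p + 1) y - ⁅(x : Completion) - x', y⁆ ∈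
      nHat (N + p + 1) := by
    obtain ⟨q, rfl⟩ := Nat.exists_eq_add_of_le hp
    simp only [partialExp, LinearMap.sum_apply]
    rw [show 1 + q + 1 = q + 1 + 1 by ring, Finset.sum_range_succ', Finset.sum_range_succ',
      Finset.sum_range_succ' _ (q + 1), Finset.sum_range_succ' _ q]
    have h4 : ∑ i ∈ Finset.range q, (expTerm x (i + 1 + 1) y - expTerm x' (i + 1 + 1) y) ∈
        nHat (N + (1 + q : ℕ) + 1) := by
      refine sum_mem fun i _ => ?_
      simp only [expTerm, LinearMap.smul_apply, ← smul_sub]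
      refine Submodule.smul_mem _ _ (nHat_mono ?_ (ad_pow_sub_mem x.2 x'.2 hxp hy (i + 1)))
      push_cast
      lia
    rw [Finset.sum_sub_distrib] at h4
    convert h4 using 1
    simp only [expTerm, LinearMap.smul_apply, zero_add, Nat.factorial_zero, Nat.factorial_one,
      Nat.cast_one, inv_one, pow_zero, pow_one, Module.End.one_apply, one_smul,
      LieAlgebra.ad_apply, sub_lie]
    abel
  rw [Nat.cast_add, Nat.cast_one, ← add_assoc] at h1 h2
  have := add_mem (sub_mem h1 h2) h3
  convert this using 1
  abel

theorem expFun_sub_mem (x x' : nIm) {p : ℕ} (hp : 1 ≤ p)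
    (hxp : (x : Completion) - x' ∈ nHat p) {N : ℤ} {y : Completion} (hy : y ∈ nHat N) :
    expFun x y - expFun x' y ∈ nHat (N + p) := by
  have h1 := nHat_mono (m := N + p) (by lia) (expFun_sub_expFun x x' hp hxp hy)
  have h2 := lie_mem_nHat hxp hy
  rw [add_comm] at h2
  simpa using add_mem h1 h2

theorem expFun_zero (y : Completion) : expFun 0 y = y := by
  obtain ⟨N, hy⟩ := exists_mem_nHat y
  rw [← sub_eq_zero]
  refine eq_zero_of_forall N fun M => ?_
  have h2 : partialExp (0 : nIm) (M + 1) y = y := by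
    simp only [partialExp, LinearMap.sum_apply]
    rw [Finset.sum_range_succ', Finset.sum_eq_zero] <;> simp [expTerm]
  have h3 := expFun_approx 0 hy (M + 1)
  rw [h2] at h3
  exact nHat_mono (by push_cast; lia) h3

theorem expFun_sub_self (x : nIm) {p : ℕ} (hp : 1 ≤ p) (hxp : (x : Completion) ∈ nHat p) {N : ℤ}
    {y : Completion} (hy : y ∈ nHat N) :
    expFun x y - y - ⁅(x : Completion), y⁆ ∈ nHat (N + p + 1) := by
  simpa [expFun_zero] using expFun_sub_expFun x 0 hp (by simpa using hxp) hy

theorem expFun_sub_self_mem (x : nIm) {p : ℕ} (hp : 1 ≤ p) (hxp : (x : Completion) ∈ nHat p)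
    {N : ℤ} {y : Completion} (hy : y ∈ nHat N) : expFun x y - y ∈ nHat (N + p) := by
  simpa [expFun_zero] using expFun_sub_mem x 0 hp (by simpa using hxp) hy

theorem expAd_apply (x : nIm) (y : Completion) : expAd x y = expFun x y := rfl

theorem mul_apply (φ ψ : Completion ≃ₗ⁅ℂ⁆ Completion) (y : Completion) :
    (φ * ψ) y = φ (ψ y) := rfl

theorem expAd_inv (x : nIm) : (expAd x)⁻¹ = expAd (-x) := by
  rw [inv_eq_iff_mul_eq_one]
  refine LieEquiv.ext fun y => ?_
  have := expFun_neg (-x) y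
  rwa [neg_neg] at this

/-! ### Solving `exp(ad x) d = d + u` by successive approximation. -/

/-- This is a Newton-type correction. If `w` solves `[d, w] = error`, then passing from `x` to `x +
w` adds `[w, d] = -error` to first order, leaving an error one degree deeper. The equation is
solvable because the error lives in positive degrees, where `ad d` is invertible. -/
theorem exists_expFun_step {n : ℕ} (hn : 1 ≤ n) {u : Completion} {m : ℕ}
    (x : nIm) (hx : (x : Completion) ∈ nHat n)
    (hxm : expFun x gradingElement - (gradingElement + u) ∈ nHat (n + m)) :
    ∃ x' : nIm, (x' : Completion) ∈ nHat n ∧ (x' : Completion) - x ∈ nHat (n + m) ∧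
      expFun x' gradingElement - (gradingElement + u) ∈ nHat (n + (m + 1 : ℕ)) := by
  obtain ⟨w, hw, hwe⟩ := exists_lie_sub_eq (k := 0) (by lia) hxm
  have hwn : w ∈ nHat n := nHat_mono (by lia) hw
  have hw1 : w ∈ nIm := nHat_mono (by lia) hw
  refine ⟨x + ⟨w, hw1⟩, add_mem hx hwn, by simpa using hw, ?_⟩
  have h1 := expFun_sub_expFun (x + ⟨w, hw1⟩) x (p := n + m) (by lia) (by simpa using hw)
    gradingElement_mem_nHat
  simp only [coe_add, add_sub_cancel_left] at h1
  rw [Int.cast_zero, zero_smul, sub_zero] at hwe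
  rw [← lie_skew, hwe] at h1
  convert h1 using 1
  · congr 1
    push_cast
    ring
  · abel

theorem exists_expFun_gradingElement {n : ℕ} (hn : 1 ≤ n) {u : Completion} (hu : u ∈ nHat n) :
    ∃ x : nIm, (x : Completion) ∈ nHat n ∧ expFun x gradingElement = gradingElement + u := by
  -- The invariants are bundled with the approximations, so that the correction step can be iterated
  -- by recursion, starting from `x = 0`.
  let T (m : ℕ) : Type := {x : nIm // (x : Completion) ∈ nHat n ∧
    expFun x gradingElement - (gradingElement + u) ∈ nHat (n + m)}
  choose step hstep using fun (m : ℕ) (x : T m) => exists_expFun_step hn x.1 x.2.1 x.2.2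
  let s : (m : ℕ) → T m := fun m => Nat.rec
    ⟨0, zero_mem _, by rw [expFun_zero]; simpa using hu⟩
    (fun m x => ⟨step m x, (hstep m x).1, (hstep m x).2.2⟩) m
  obtain ⟨x, hx, hxs⟩ := exists_limit (N := n) (s := fun m => ((s m).1 : Completion)) (s 0).2.1
    fun m : ℕ => (hstep m (s m)).2.1
  have hx1 : x ∈ nIm := nHat_mono (by lia) hx
  refine ⟨⟨x, hx1⟩, hx, ?_⟩
  rw [← sub_eq_zero]
  refine eq_zero_of_forall n fun M => ?_
  -- The limit and the `M`-th approximation differ in `nHat (n + M)`, hence so do their exponentials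
  -- applied to the grading element.
  have h1 := expFun_sub_mem ⟨x, hx1⟩ (s M).1 (p := n + M) (by lia) (by simpa using hxs M)
    gradingElement_mem_nHat
  rw [zero_add, Nat.cast_add] at h1
  simpa using add_mem h1 (s M).2.2

/-! ### Rigidity of automorphisms that fix the grading element. -/

/-- An automorphism fixing the grading element preserves the filtration. -/
theorem map_mem_nHat {φ : Completion ≃ₗ⁅ℂ⁆ Completion} (hφ : φ gradingElement = gradingElement)
    {M : ℤ} {y : Completion} (hy : y ∈ nHat M) : φ y ∈ nHat M := by
  intro k hk
  -- For `k < M`, an element of `nHat M` lies in the image of `ad d - k`. Since `φ` commutes with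
  -- this operator, `φ y` lies there too, and such elements have no degree-`k` component.
  obtain ⟨w, -, rfl⟩ := exists_lie_sub_eq hk hy
  rw [map_sub, map_smul, LieEquiv.map_lie, hφ, map_sub, comp_gradingElement_lie, map_smul, sub_self]

theorem exists_homogeneous_sum (y : Completion) {N : ℤ} (hy : y ∈ nHat N) (M : ℕ) :
    ∃ g : ℕ → Completion, (∀ i : ℕ, g i ∈ homogeneous (N + i)) ∧
      y - ∑ i ∈ Finset.range M, g i ∈ nHat (N + M) := by
  let g (i : ℕ) : Completion := ofComponents (Pi.single (N + i) (comp (N + i) y)) N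
    (fun k hk => by rw [Pi.single_eq_of_ne (by lia)])
    (fun k => by
      rcases eq_or_ne k (N + i) with rfl | hk
      · simpa using comp_mem_piece y _
      · rw [Pi.single_eq_of_ne hk]; exact zero_mem _)
  refine ⟨g, fun i k hk => by rw [comp_ofComponents, Pi.single_eq_of_ne hk], fun k hk => ?_⟩
  rw [map_sub, map_sum]
  simp only [g, comp_ofComponents]
  by_cases hkN : k < N
  · rw [hy k hkN, Finset.sum_eq_zero fun i _ => Pi.single_eq_of_ne (by lia) _, sub_zero]
  · obtain ⟨j, rfl⟩ := Int.le.dest (not_lt.1 hkN)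
    rw [Finset.sum_eq_single_of_mem j (by simpa using hk)
      fun i _ hi => Pi.single_eq_of_ne (by lia) _, Pi.single_eq_same, sub_self]

/-- Elements of the completion are infinite sums and `φ` is not assumed continuous, so agreement on
homogeneous elements must be extended. The hypothesis includes that `φ` fixes the grading element;
thus `φ` preserves the filtration, and finite truncations suffice. -/
theorem eq_one_of_fixes {φ : Completion ≃ₗ⁅ℂ⁆ Completion}
    (hφ : ∀ k, ∀ y ∈ homogeneous k, φ y = y) : φ = 1 := by
  refine LieEquiv.ext fun y => ?_
  obtain ⟨N, hy⟩ := exists_mem_nHat y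
  change φ y = y
  rw [← sub_eq_zero]
  refine eq_zero_of_forall N fun M => ?_
  obtain ⟨g, hg, hyg⟩ := exists_homogeneous_sum y hy M
  have h1 := map_mem_nHat (hφ 0 _ gradingElement_mem_homogeneous) hyg
  rw [map_sub, map_sum, Finset.sum_congr rfl fun i _ => hφ _ _ (hg i)] at h1
  simpa using sub_mem h1 hyg

/-- For `y` of degree `k`, `φ y` is again an eigenvector of `ad d` for `k`, hence of degree `k`. But
`φ y - y` has only components in degrees above `k`, so it is zero. -/
theorem eq_one_of_fixes_gradingElement {φ : Completion ≃ₗ⁅ℂ⁆ Completion} (hφ : φ ∈ uHat 1)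
    (hd : φ gradingElement = gradingElement) : φ = 1 := by
  refine eq_one_of_fixes fun k y hy => ?_
  have h1 : φ y ∈ homogeneous k := by
    refine mem_homogeneous_of_lie ?_
    nth_rw 1 [← hd]
    rw [← LieEquiv.map_lie, gradingElement_lie hy, map_smul]
  have h2 := sub_mem h1 hy
  have h3 := hφ k y hy
  rw [← sub_eq_zero]
  ext l
  rw [map_zero]
  rcases eq_or_ne l k with rfl | hl
  · exact h3 l (by simp)
  · exact h2 l hl

/-! ### The sets `uHat p` as exponentials, and their group structure. -/

theorem mem_uHat_of_nHat {p : ℕ} {φ : Completion ≃ₗ⁅ℂ⁆ Completion}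
    (h : ∀ (k : ℤ), ∀ y ∈ nHat k, φ y - y ∈ nHat (k + p)) : φ ∈ uHat p :=
  fun k y hy => h k y (homogeneous_le_nHat k hy)

theorem uHat_eq {n : ℕ} (hn : 1 ≤ n) :
    uHat n = expAd '' {x : nIm | (x : Completion) ∈ nHat n} := by
  refine Set.Subset.antisymm (fun φ hφ => ?_) ?_
  · have h0 := hφ 0 _ gradingElement_mem_homogeneous
    rw [zero_add] at h0
    obtain ⟨x, hx, hxe⟩ := exists_expFun_gradingElement hn h0
    rw [add_sub_cancel] at hxe
    refine ⟨x, hx, ?_⟩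
    -- The choice of `x` makes this product fix the grading element. Rigidity asks beyond that only
    -- for membership in `uHat 1`, which follows from the filtration estimates for `φ` and
    -- `exp(ad(-x))`.
    have h1 : (expAd x)⁻¹ * φ = 1 := by
      rw [expAd_inv]
      refine eq_one_of_fixes_gradingElement (fun k y hy => ?_) ?_
      · have hy' := homogeneous_le_nHat k hy
        have h2 := nHat_mono (m := k + 1) (by lia) (expFun_mem (-x) (hφ k y hy))
        have h3 := expFun_sub_self_mem (-x) le_rfl (-x).2 hy'
        have := add_mem h2 h3
        rw [← expAd_apply, map_sub, ← expAd_apply, sub_add_sub_cancel] at this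
        exact this
      · rw [mul_apply, ← hxe]
        exact expFun_neg x _
    exact inv_mul_eq_one.1 h1
  · rintro _ ⟨x, hx, rfl⟩
    exact mem_uHat_of_nHat fun k y hy => expFun_sub_self_mem x hn hx hy

/-- The definition of `uHat p` controls `φ` on homogeneous elements only. The estimate reaches
infinite sums because `φ` is now known to be an exponential. -/
theorem sub_mem_of_mem_uHat {p : ℕ} (hp : 1 ≤ p) {φ : Completion ≃ₗ⁅ℂ⁆ Completion}
    (hφ : φ ∈ uHat p) {k : ℤ} {y : Completion} (hy : y ∈ nHat k) : φ y - y ∈ nHat (k + p) := by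
  rw [uHat_eq hp] at hφ
  obtain ⟨x, hx, rfl⟩ := hφ
  exact expFun_sub_self_mem x hp hx hy

theorem mul_mem_uHat {p : ℕ} (hp : 1 ≤ p) {φ ψ : Completion ≃ₗ⁅ℂ⁆ Completion}
    (hφ : φ ∈ uHat p) (hψ : ψ ∈ uHat p) : φ * ψ ∈ uHat p := by
  refine mem_uHat_of_nHat fun k y hy => ?_
  have h1 := sub_mem_of_mem_uHat hp hψ hy
  have h2 : ψ y ∈ nHat k := by
    simpa using add_mem (nHat_mono (by lia) h1) hy
  simpa [mul_apply] using add_mem (sub_mem_of_mem_uHat hp hφ h2) h1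

theorem inv_mem_uHat {p : ℕ} (hp : 1 ≤ p) {φ : Completion ≃ₗ⁅ℂ⁆ Completion}
    (hφ : φ ∈ uHat p) : φ⁻¹ ∈ uHat p := by
  rw [uHat_eq hp] at hφ ⊢
  obtain ⟨x, hx, rfl⟩ := hφ
  exact ⟨-x, (nHat p).neg_mem hx, (expAd_inv x).symm⟩

theorem expAd_mem_uHat_one (x : nIm) : expAd x ∈ uHat 1 := by
  rw [uHat_eq le_rfl]
  exact ⟨x, x.2, rfl⟩

theorem map_mem_nHat_of_mem_uHat {φ : Completion ≃ₗ⁅ℂ⁆ Completion} (hφ : φ ∈ uHat 1) {k : ℤ}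
    {y : Completion} (hy : y ∈ nHat k) : φ y ∈ nHat k := by
  simpa using add_mem (nHat_mono (by lia) (sub_mem_of_mem_uHat le_rfl hφ hy)) hy

/-- Two automorphisms that agree up to a shift by `p` differ by an element of `Û⁺_p`. -/
theorem inv_mul_mem_uHat {p : ℕ} {φ ψ : Completion ≃ₗ⁅ℂ⁆ Completion} (hψ : ψ ∈ uHat 1)
    (h : ∀ (k : ℤ), ∀ y ∈ nHat k, φ y - ψ y ∈ nHat (k + p)) : ψ⁻¹ * φ ∈ uHat p := by
  refine mem_uHat_of_nHat fun k y hy => ?_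
  -- Applying `ψ⁻¹`, which preserves the filtration, turns `φ y - ψ y` into `ψ⁻¹ φ y - y`.
  have := map_mem_nHat_of_mem_uHat (inv_mem_uHat le_rfl hψ) (h k y hy)
  rw [map_sub, ← mul_apply, ← mul_apply, inv_mul_cancel] at this
  exact this

theorem image_mul_uHat_eq {p : ℕ} (hp : 1 ≤ p) {φ ψ : Completion ≃ₗ⁅ℂ⁆ Completion}
    (h : ψ⁻¹ * φ ∈ uHat p) : (fun χ => φ * χ) '' uHat p = (fun χ => ψ * χ) '' uHat p := by
  have hsub : ∀ {φ ψ : Completion ≃ₗ⁅ℂ⁆ Completion}, ψ⁻¹ * φ ∈ uHat p →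
      (fun χ => φ * χ) '' uHat p ⊆ (fun χ => ψ * χ) '' uHat p := by
    rintro φ ψ h _ ⟨χ, hχ, rfl⟩
    exact ⟨ψ⁻¹ * φ * χ, mul_mem_uHat hp h hχ, by group⟩
  refine (hsub h).antisymm (hsub ?_)
  have := inv_mem_uHat hp h
  rwa [mul_inv_rev, inv_inv] at this

/-! ### Conjugation, and congruences for cosets, sums and brackets. -/

/-- `φ exp(ad y) = exp(ad φ(y)) φ` for `φ ∈ Û⁺_1`. -/
theorem map_expFun {φ : Completion ≃ₗ⁅ℂ⁆ Completion} (hφ : φ ∈ uHat 1) (y y' : nIm)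
    (hy : (y' : Completion) = φ y) (z : Completion) : φ (expFun y z) = expFun y' (φ z) := by
  obtain ⟨N, hz⟩ := exists_mem_nHat z
  rw [← sub_eq_zero]
  refine eq_zero_of_forall N fun M => ?_
  have h1 := map_mem_nHat_of_mem_uHat hφ (expFun_approx y hz M)
  have h2 := expFun_approx y' (map_mem_nHat_of_mem_uHat hφ hz) M
  -- Term by term, `φ` intertwines `ad y` with `ad (φ y)`. The tails are negligible because `φ`
  -- preserves the filtration.
  have h3 : ∀ i, φ (expTerm y i z) = expTerm y' i (φ z) := by
    intro i
    simp only [expTerm, LinearMap.smul_apply, map_smul]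
    congr 1
    induction i with
    | zero => rfl
    | succ i ih =>
      simp only [pow_succ', Module.End.mul_apply, LieAlgebra.ad_apply, LieEquiv.map_lie, ih, hy]
  have h4 : φ (partialExp y M z) = partialExp y' M (φ z) := by
    simp only [partialExp, LinearMap.sum_apply, map_sum, h3]
  rw [map_sub, h4] at h1
  simpa using sub_mem h1 h2

/-- A product `exp(ad x) ψ` is some `exp(ad w)` by `uHat_eq`. Evaluating at the grading element
shows that `[w - x, d]` starts in degree `n + 1`, and therefore so does `w - x`. The reverse
inclusion is the first-order estimate. -/
theorem expAd_mul_uHat {n : ℕ} (hn : 1 ≤ n) (x : nIm) (hx : (x : Completion) ∈ nHat n) :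
    (fun ψ => expAd x * ψ) '' uHat (n + 1) =
      expAd '' {w : nIm | ∃ z : nIm, (z : Completion) ∈ nHat (n + 1) ∧ w = x + z} := by
  refine Set.Subset.antisymm ?_ ?_
  · rintro _ ⟨ψ, hψ, rfl⟩
    have hψn : ψ ∈ uHat n := fun k y hy => nHat_mono (by push_cast; lia) (hψ k y hy)
    have hxn : expAd x ∈ uHat n := by rw [uHat_eq hn]; exact ⟨x, hx, rfl⟩
    have hmul := mul_mem_uHat hn hxn hψn
    rw [uHat_eq hn] at hmul
    obtain ⟨w, hw, hwe⟩ := hmul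
    refine ⟨w, ⟨w - x, fun k hk => ?_, by abel⟩, hwe⟩
    have hwx := sub_mem hw hx
    have h1 := expFun_sub_expFun w x hn hwx gradingElement_mem_nHat
    have h2 := expFun_mem x (hψ 0 _ gradingElement_mem_homogeneous)
    rw [← expAd_apply, ← expAd_apply, hwe] at h1
    rw [← expAd_apply, map_sub] at h2
    have h3 := sub_mem (nHat_mono (m := 0 + (n + 1 : ℕ)) (by push_cast; lia) h1) h2
    rw [mul_apply, sub_sub_cancel_left, neg_mem_iff, ← lie_skew, neg_mem_iff] at h3
    have h4 := h3 k (by push_cast; lia)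
    rw [comp_gradingElement_lie, smul_eq_zero] at h4
    -- The eigenvalue vanishes only in degree `0`, where `w - x ∈ nHat n` with `n ≥ 1` already gives
    -- the claim.
    rcases h4 with h4 | h4
    · exact hwx k (by rw [Int.cast_eq_zero.1 h4]; exact_mod_cast hn)
    · exact h4
  · rintro _ ⟨_, ⟨z, hz, rfl⟩, rfl⟩
    refine ⟨(expAd x)⁻¹ * expAd (x + z), ?_, mul_inv_cancel_left _ _⟩
    refine inv_mul_mem_uHat (expAd_mem_uHat_one x) fun k y hy => ?_
    exact expFun_sub_mem _ _ (by lia) (by simpa using hz) hy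

/-- Both automorphisms send `z` to `z + [x, z] + [y, z]` modulo `nHat (k + n + 1)`. The mixed term
`[x, exp(ad y) z - z]` is raised by `2n ≥ n + 1`. -/
theorem expAd_add_congr {n : ℕ} (hn : 1 ≤ n) (x y : nIm) (hx : (x : Completion) ∈ nHat n)
    (hy : (y : Completion) ∈ nHat n) :
    (expAd x * expAd y)⁻¹ * expAd (x + y) ∈ uHat (n + 1) := by
  refine inv_mul_mem_uHat (mul_mem_uHat le_rfl (expAd_mem_uHat_one x) (expAd_mem_uHat_one y))
    fun k z hz => ?_
  rw [mul_apply, expAd_apply, expAd_apply, expAd_apply]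
  have h1 := expFun_sub_self (x + y) hn (add_mem hx hy) hz
  have h2 := expFun_sub_self y hn hy hz
  have h3 := expFun_sub_self x hn hx (expFun_mem y hz)
  have h4 := lie_mem_nHat hx (expFun_sub_self_mem y hn hy hz)
  have h5 := sub_mem (sub_mem (sub_mem h1 h2) h3)
    (nHat_mono (m := k + n + 1) (by lia) h4)
  rw [Nat.cast_add, Nat.cast_one, ← add_assoc]
  convert h5 using 1
  simp only [coe_add, add_lie, lie_sub]
  abel

/-- Write `X`, `Y` for the two exponentials. By conjugation `X Y z = exp(ad (X y)) X z`, and `X y`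
is `y + [x, y]` up to higher degree. Hence `X Y z - Y X z` is `[[x, y], X z]` to first order, which
is the effect of `exp(ad [x, y])` on `v = Y X z`. -/
theorem expAd_lie_congr {n m : ℕ} (hn : 1 ≤ n) (hm : 1 ≤ m) (x y : nIm)
    (hx : (x : Completion) ∈ nHat n) (hy : (y : Completion) ∈ nHat m) :
    (expAd x * expAd y * (expAd x)⁻¹ * (expAd y)⁻¹)⁻¹ * expAd ⁅x, y⁆ ∈ uHat (n + m + 1) := by
  have hX := expAd_mem_uHat_one x
  have hY := expAd_mem_uHat_one y
  refine inv_mul_mem_uHat (mul_mem_uHat le_rfl (mul_mem_uHat le_rfl (mul_mem_uHat le_rfl hX hY)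
    (inv_mem_uHat le_rfl hX)) (inv_mem_uHat le_rfl hY)) fun k v hv => ?_
  -- Writing the argument as `Y X z` removes the inverses: the commutator sends it to `X Y z`.
  obtain ⟨z, hz, rfl⟩ : ∃ z ∈ nHat k, (expAd y * expAd x) z = v := by
    refine ⟨(expAd y * expAd x)⁻¹ v, map_mem_nHat_of_mem_uHat
      (inv_mem_uHat le_rfl (mul_mem_uHat le_rfl hY hX)) hv, ?_⟩
    rw [← mul_apply, mul_inv_cancel]
    rfl
  rw [← mul_apply (_ * _), show expAd x * expAd y * (expAd x)⁻¹ * (expAd y)⁻¹ *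
    (expAd y * expAd x) = expAd x * expAd y by group]
  have hXz : expFun x z ∈ nHat k := expFun_mem x hz
  have hxy : ((⁅x, y⁆ : nIm) : Completion) ∈ nHat (n + m : ℕ) := by
    rw [Nat.cast_add]; exact lie_mem_nHat hx hy
  have hXy : expFun x y ∈ nIm := expFun_mem x y.2
  have h1 := expFun_sub_self ⁅x, y⁆ (by lia) hxy hv
  have h2 := expFun_sub_self_mem x hn hx hy
  rw [add_comm, ← Nat.cast_add] at h2
  have h3 := expFun_sub_expFun ⟨expFun x y, hXy⟩ y (by lia) h2 hXz
  have h4 := map_expFun hX y ⟨expFun x y, hXy⟩ rfl z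
  -- The last two estimates replace `X y - y` by `[x, y]`, and then `X z` by `Y X z` inside the
  -- bracket with `[x, y]`. The second replacement gains a degree because `m ≥ 1`.
  have h5 := lie_mem_nHat (expFun_sub_self x hn hx hy) hXz
  have h6 := lie_mem_nHat hxy (expFun_sub_self_mem y hm hy hXz)
  rw [mul_apply, expAd_apply, expAd_apply] at h1
  rw [expAd_apply, expAd_apply] at h4
  simp only [mul_apply, expAd_apply]
  rw [h4, Nat.cast_add,
    Nat.cast_one, ← add_assoc]
  have h7 := add_mem (sub_mem (sub_mem h1 h3)
    (nHat_mono (m := k + (n + m : ℕ) + 1) (by push_cast; lia) h5))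
    (nHat_mono (m := k + (n + m : ℕ) + 1) (by push_cast; lia) h6)
  convert h7 using 1
  simp only [LieSubalgebra.coe_bracket, sub_lie, lie_sub]
  abel

end Completion

end MonsterLie

open MonsterLie (Completion)
open MonsterLie.Completion (uHat expAd nIm nHat homogeneous)
/-- For `n ≥ 1`, in the automorphism group of the completion `𝔪̂` of the Monster Lie algebra:
`Û⁺_n = exp(ad 𝔫̂⁺_n)`; `exp(ad x) Û⁺_{n+1} = exp(ad(x + 𝔫̂⁺_{n+1}))` for `x ∈ 𝔪_n`;
`exp(ad(x + y)) Û⁺_{n+1} = exp(ad x) exp(ad y) Û⁺_{n+1}` for `x, y ∈ 𝔪_n`; and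
`exp(ad [x, y]) ∈ (exp(ad x), exp(ad y)) Û⁺_{n+m+1}` for `x ∈ 𝔪_n`, `y ∈ 𝔪_m`, `m ≥ 1`, where
`(X, Y) = X Y X⁻¹ Y⁻¹`. -/
theorem mainTheorem3 (n : ℕ) (hn : 1 ≤ n) :
    uHat n = expAd '' {x : nIm | (x : Completion) ∈ nHat n} ∧
    (∀ x : nIm, (x : Completion) ∈ homogeneous n →
      (fun ψ => expAd x * ψ) '' uHat (n + 1) =
        expAd '' {w : nIm | ∃ z : nIm, (z : Completion) ∈ nHat (n + 1) ∧ w = x + z}) ∧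
    (∀ x y : nIm, (x : Completion) ∈ homogeneous n → (y : Completion) ∈ homogeneous n →
      (fun ψ => expAd (x + y) * ψ) '' uHat (n + 1) =
        (fun ψ => expAd x * expAd y * ψ) '' uHat (n + 1)) ∧
    (∀ m : ℕ, 1 ≤ m → ∀ x y : nIm,
      (x : Completion) ∈ homogeneous n → (y : Completion) ∈ homogeneous m →
        expAd ⁅x, y⁆ ∈
          (fun ψ => (expAd x * expAd y * (expAd x)⁻¹ * (expAd y)⁻¹) * ψ) '' uHat (n + m + 1)) := by
  refine ⟨MonsterLie.Completion.uHat_eq hn, fun x hx => ?_, fun x y hx hy => ?_,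
    fun m hm x y hx hy => ?_⟩
  · exact MonsterLie.Completion.expAd_mul_uHat hn x
      (MonsterLie.Completion.homogeneous_le_nHat n hx)
  · exact MonsterLie.Completion.image_mul_uHat_eq (by lia)
      (MonsterLie.Completion.expAd_add_congr hn x y
        (MonsterLie.Completion.homogeneous_le_nHat n hx)
        (MonsterLie.Completion.homogeneous_le_nHat n hy))
  · exact ⟨_, MonsterLie.Completion.expAd_lie_congr hn hm x y
      (MonsterLie.Completion.homogeneous_le_nHat n hx)
      (MonsterLie.Completion.homogeneous_le_nHat m hy), mul_inv_cancel_left _ _⟩
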